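/- All languages are countable, and countable structures have domain $\omega$. **Formulas.** $\forall_0=\exists_0$ is the class of quantifier-free formulas; a $\forall_{n+1}$-formula is a block of universal quantifiers followed by an $\exists_n$-formula, and an $\exists_{n+1}$-formula is a block of existential quantifiers followed by a $\forall_n$-formula. A theory is $\forall_n$-axiomatizable if it has an axiomatization (in its language) by $\forall_n$-sentences. A type $p(x)$ in a language $\mathcal L$ is regarded as the theory $p(a)$ in $\mathcal L\cup\{a\}$, with $a$ a new constant. **Hardness.** Fix any listing $(\varphi_i)_{i\in\omega}$ of the atomic $(\mathcal L\cup\omega)$-sentences, the elements of $\omega$ being regarded as constants, and identify a structure with domain $\omega$ with its atomic diagram in $2^\omega$. $\mathrm{Mod}(T)\subseteq 2^\omega$ is the set of models of $T$ with domain $\omega$. A set is $\mathbf\Pi^0_\omega$ if it is a countable intersection of sets each of which is $\mathbf\Sigma^0_n$ for some $1\le n<\omega$. A theory $T$ is $\mathbf\Pi^0_\omega$-hard if for every $\mathbf\Pi^0_\omega$ set $S\subseteq 2^\omega$ there is a continuous $f:2^\omega\to2^\omega$ with $S=f^{-1}(\mathrm{Mod}(T))$. **The theory.** Let $\mathcal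 L_0=\{P_i\mid i\in\omega\}\cup\{<_i\mid i\in\omega\}$ with $P_i$ unary and $<_i$ binary, and let $T_0$ say, for all $i\neq j$: $P_i\cap P_j=\emptyset$; $<_i\subseteq P_i\times P_{i+1}$; every $x\in P_{i+1}$ has some $y\in P_i$ with $y<_i x$; and $x<_iy\wedge x'<_iy\to x=x'$. (Models are forests, $P_i$ being the $i$-th level, plus elements lying on no level.) Let $(\mathcal M_i)_i$ list the finite models of $T_0$ up to isomorphism. For all $i$ and $j<\omega$ let $C_i^j$ be a set of $|M_i|$ new constants, all these sets being disjoint, with a fixed bijection $M_i\to C_i^j$; let $C=\bigcup_{i,j}C_i^j$ and $\tilde{\mathcal L}=\mathcal L_0\cup C$. Let $T$ be the $\tilde{\mathcal L}$-theory saying: $T_0$; the constants in $C$ are pairwise distinct; the fixed bijection is an isomorphism of $\mathcal M_i$ onto the $\mathcal L_0$-substructure with domain $C_i^j$; and, for each $k$, if $x\in C_i^j$ and ($x<_ky$ or $y<_kx$), then $y\in C_i^j$. **The tree.** Let $A_1$ be a single node and $E_1$ a root with infinitely many leaves as its children; let $A_{k+1}$ be a root with infinitely many copies of $E_k$ above it,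 and $E_{k+1}$ a root with infinitely many copies of $A_k$ and infinitely many copies of $E_k$ above it (all infinities are countable). Let $\mathcal N$ be the tree consisting of a root $F_0$, for each $k\ge1$ a non-branching path (the paths for different $k$ meeting only in $F_0$) up to a node on level $2k-1$ which has exactly two children $F_k$ and $G_k$ on level $2k$, where $F_k$ is a leaf and the tree above $G_k$ is a copy of $E_k$. Regard $\mathcal N$ as an $\mathcal L_0$-structure, with $P_i$ its $i$-th level and $<_i$ the child relation between levels $i$ and $i+1$. Let $\mathcal M$ be the $\tilde{\mathcal L}$-structure $\mathcal C\sqcup\mathcal N$, where $\mathcal C$ is the model of $T$ consisting of the constants only. **Theorem.** $\mathcal M\models T$, each $G_k$ ($k\ge 1$) is definable in $\mathcal M$ from the root $F_0$ by an $\mathcal L_0$-formula, and the complete type $p(x)\in S_1(T)$ of $F_0$ in $\mathcal M$ is $\mathbf\Pi^0_\omega$-hard. In particular, there is a complete $1$-type over $T$ which is $\mathbf\Pi^0_\omega$-hard; moreover $p$ is not $\forall_n$-axiomatizable for any finite $n$. -/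

import Mathlib

open FirstOrder FirstOrder.Language

namespace UnboundedType

/-! ### The hierarchy of prenex formulas -/

section Prenex

universe u v w

variable {L : FirstOrder.Language.{u, v}} {α : Type w}

/-- The formulas `∀ x₁ … ∀ xₘ φ` with `m` arbitrary and `φ` in the class `K`. -/
inductive AllBlock (K : ∀ n : ℕ, L.BoundedFormula α n → Prop) :
    ∀ n : ℕ, L.BoundedFormula α n → Prop
  | base {n : ℕ} {φ : L.BoundedFormula α n} (h : K n φ) : AllBlock K n φ
  | all {n : ℕ} {φ : L.BoundedFormula α (n + 1)} (h : AllBlock K (n + 1) φ) : AllBlock K n φ.all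

/-- The formulas `∃ x₁ … ∃ xₘ φ` with `m` arbitrary and `φ` in the class `K`. -/
inductive ExBlock (K : ∀ n : ℕ, L.BoundedFormula α n → Prop) :
    ∀ n : ℕ, L.BoundedFormula α n → Prop
  | base {n : ℕ} {φ : L.BoundedFormula α n} (h : K n φ) : ExBlock K n φ
  | ex {n : ℕ} {φ : L.BoundedFormula α (n + 1)} (h : ExBlock K (n + 1) φ) : ExBlock K n φ.ex

/-- `prenexClass true k` is the class of `∀ₖ`-formulas, `prenexClass false k` that of
`∃ₖ`-formulas. -/
def prenexClass : Bool → ℕ → ∀ n : ℕ, L.BoundedFormula α n → Prop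
  | _, 0 => fun _ φ => φ.IsQF
  | true, k + 1 => AllBlock (prenexClass false k)
  | false, k + 1 => ExBlock (prenexClass true k)

/-- A sentence is `∀ₖ`. -/
def IsForallSentence (k : ℕ) (φ : L.Sentence) : Prop :=
  prenexClass true k 0 φ

/-- The theory `T` has an axiomatization consisting of `∀ₖ`-sentences of its language. -/
def IsForallAxiomatizable (k : ℕ) (T : L.Theory) : Prop :=
  ∃ Γ : L.Theory, (∀ φ ∈ Γ, IsForallSentence k φ) ∧ ∀ ψ : L.Sentence, Γ ⊨ᵇ ψ ↔ T ⊨ᵇ ψ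

end Prenex

/-! ### The Borel hierarchy up to level `ω`, and hardness -/

section Borel

variable {X : Type*} [TopologicalSpace X]

/-- The boldface class `Σ⁰ₙ` of a (metrizable) space, for `n ≥ 1`; there is no level `0`. -/
def boldSigma : ℕ → Set (Set X)
  | 0 => ∅
  | 1 => {s | IsOpen s}
  | n + 2 => {s | ∃ t : ℕ → Set X, (∀ i, (t i)ᶜ ∈ boldSigma (n + 1)) ∧ s = ⋃ i, t i}

/-- The boldface class `Π⁰_ω`: the countable intersections of sets that lie in some `Σ⁰ₙ`, where
`1 ≤ n < ω`. -/
def boldPiOmega : Set (Set X) :=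
  {s | ∃ t : ℕ → Set X, (∀ i, ∃ n : ℕ, 1 ≤ n ∧ t i ∈ boldSigma n) ∧ s = ⋂ i, t i}

/-- A subset `B` of Cantor space is `Π⁰_ω`-hard: every `Π⁰_ω` subset of Cantor space is a
continuous preimage of `B`. -/
def IsPiOmegaHard (B : Set (ℕ → Bool)) : Prop :=
  ∀ S : Set (ℕ → Bool), S ∈ boldPiOmega →
    ∃ f : (ℕ → Bool) → (ℕ → Bool), Continuous f ∧ ∀ x, x ∈ S ↔ f x ∈ B

end Borel

/-! ### The set of models of a theory as a subset of Cantor space -/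

section Mod

universe u v

/-- The atomic `(L ∪ ω)`-sentences, the elements of `ω` being new constants. -/
abbrev AtomicSentence (L : FirstOrder.Language.{u, v}) : Type (max u v) :=
  {φ : L[[ℕ]].Sentence // BoundedFormula.IsAtomic φ}

variable {L : FirstOrder.Language.{u, v}}

open Classical in
/-- The atomic diagram of an `L`-structure with domain `ω`, along a listing `e` of the atomic
`(L ∪ ω)`-sentences. -/
noncomputable def atomicDiagram (e : ℕ → AtomicSentence L) (S : L.Structure ℕ) : ℕ → Bool :=
  fun i => decide (ℕ ⊨ (e i).1)

/-- `Mod(T)`: the set of (atomic diagrams of) models of `T` with domain `ω`. -/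
def modSet (e : ℕ → AtomicSentence L) (T : L.Theory) : Set (ℕ → Bool) :=
  {x | ∃ S : L.Structure ℕ, ℕ ⊨ T ∧ atomicDiagram e S = x}

end Mod

/-! ### The base language and the base theory -/

/-- The relation symbols: unary `Pᵢ` and binary `<ᵢ`. -/
inductive ForestRel : ℕ → Type
  | level (i : ℕ) : ForestRel 1
  | below (i : ℕ) : ForestRel 2

/-- The language `L₀ = {Pᵢ | i ∈ ω} ∪ {<ᵢ | i ∈ ω}`. -/
abbrev forestLang : FirstOrder.Language.{0, 0} := ⟨fun _ => Empty, ForestRel⟩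

/-- `Pᵢ(t)`. -/
abbrev pred {α : Type} {n : ℕ} (i : ℕ) (t : forestLang.Term (α ⊕ Fin n)) :
    forestLang.BoundedFormula α n :=
  Relations.boundedFormula₁ (L := forestLang) (ForestRel.level i) t

/-- `s <ᵢ t`. -/
abbrev less {α : Type} {n : ℕ} (i : ℕ) (s t : forestLang.Term (α ⊕ Fin n)) :
    forestLang.BoundedFormula α n :=
  Relations.boundedFormula₂ (L := forestLang) (ForestRel.below i) s t

/-- `Pᵢ ∩ Pⱼ = ∅`. -/
def disjointAx (i j : ℕ) : forestLang.Sentence :=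
  ∀' ∼(pred i (&0) ⊓ pred j (&0))

/-- `<ᵢ ⊆ Pᵢ × Pᵢ₊₁`. -/
def levelAx (i : ℕ) : forestLang.Sentence :=
  ∀' ∀' (less i (&0) (&1) ⟹ (pred i (&0) ⊓ pred (i + 1) (&1)))

/-- Every element of `Pᵢ₊₁` has a predecessor in `Pᵢ`. -/
def existsPredAx (i : ℕ) : forestLang.Sentence :=
  ∀' (pred (i + 1) (&0) ⟹ ∃' (pred i (&1) ⊓ less i (&1) (&0)))

/-- Predecessors are unique. -/
def uniquePredAx (i : ℕ) : forestLang.Sentence :=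
  ∀' ∀' ∀' ((less i (&0) (&2) ⊓ less i (&1) (&2)) ⟹ ((&0) =' (&1)))

/-- The base theory `T₀`: its models are forests with named levels, together with elements that
are on no level. -/
def forestTheory : forestLang.Theory :=
  {φ | ∃ i j : ℕ, i ≠ j ∧ φ = disjointAx i j} ∪ Set.range levelAx ∪ Set.range existsPredAx ∪
    Set.range uniquePredAx

/-- The `L₀`-structure on `M` with given levels and given relations `<ᵢ`. -/
abbrev mkForest {M : Type} (P : ℕ → M → Prop) (lt : ℕ → M → M → Prop) : forestLang.Structure M where
  funMap := fun f => Empty.elim f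
  RelMap := fun {_} r =>
    match r with
    | .level i => fun x => P i (x 0)
    | .below i => fun x => lt i (x 0) (x 1)

/-- `a ∈ Pᵢ` in the `L₀`-structure `M`. -/
abbrev OnLevel {M : Type} [forestLang.Structure M] (i : ℕ) (a : M) : Prop :=
  Structure.RelMap (L := forestLang) (ForestRel.level i) ![a]

/-- `a <ᵢ b` in the `L₀`-structure `M`. -/
abbrev Below {M : Type} [forestLang.Structure M] (i : ℕ) (a b : M) : Prop :=
  Structure.RelMap (L := forestLang) (ForestRel.below i) ![a, b]

/-- The disjoint union of two `L₀`-structures. -/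
instance sumForest {M N : Type} [forestLang.Structure M] [forestLang.Structure N] :
    forestLang.Structure (M ⊕ N) :=
  mkForest
    (fun i x => match x with
      | .inl a => OnLevel i a
      | .inr a => OnLevel i a)
    (fun i x y => match x, y with
      | .inl a, .inl b => Below i a b
      | .inr a, .inr b => Below i a b
      | _, _ => False)

/-! ### The finite models of the base theory, the new constants, and the theory -/

/-- A model of `T₀` on a finite set `{0, …, n - 1}`. -/
structure FinModel where
  size : ℕ
  str : forestLang.Structure (Fin size)
  isModel : Fin size ⊨ forestTheory

/-- Isomorphism of finite models. -/
instance finModelSetoid : Setoid FinModel where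
  r a b := letI := a.str; letI := b.str; Nonempty (Fin a.size ≃[forestLang] Fin b.size)
  iseqv :=
    { refl := fun a => letI := a.str; ⟨FirstOrder.Language.Equiv.refl forestLang _⟩
      symm := fun {a b} h => letI := a.str; letI := b.str; h.map FirstOrder.Language.Equiv.symm
      trans := fun {a b c} h h' =>
        letI := a.str; letI := b.str; letI := c.str; h.elim fun f => h'.map fun g => g.comp f }

/-- The isomorphism types of finite models of `T₀`. -/
abbrev FinModelType : Type := Quotient finModelSetoid

/-- The underlying set of the chosen finite model `Mᵢ` of isomorphism type `i`. -/
abbrev Rep (i : FinModelType) : Type := Fin i.out.size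

noncomputable instance repStructure (i : FinModelType) : forestLang.Structure (Rep i) := i.out.str

/-- The new constants: for every `i` and every `j < ω` a set `Cᵢʲ` of `|Mᵢ|` constants, indexed by
the elements of `Mᵢ`. -/
abbrev NewConst : Type := Σ i : FinModelType, ℕ × Rep i

/-- The language `L₀ ∪ C`. -/
abbrev treeLang : FirstOrder.Language.{0, 0} := forestLang[[NewConst]]

/-- A new constant as a term. -/
abbrev constTerm {n : ℕ} (c : NewConst) : treeLang.Term (Empty ⊕ Fin n) :=
  Constants.term (forestLang.con c)

/-- The relation symbol `Pₖ` of `L₀ ∪ C`. -/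
abbrev levelSymb (k : ℕ) : treeLang.Relations 1 :=
  (forestLang.lhomWithConstants NewConst).onRelation (ForestRel.level k)

/-- The relation symbol `<ₖ` of `L₀ ∪ C`. -/
abbrev belowSymb (k : ℕ) : treeLang.Relations 2 :=
  (forestLang.lhomWithConstants NewConst).onRelation (ForestRel.below k)

/-- The sentence `Pₖ(c)`. -/
def levelSentence (k : ℕ) (c : NewConst) : treeLang.Sentence :=
  (levelSymb k).boundedFormula₁ (constTerm c)

/-- The sentence `c <ₖ d`. -/
def belowSentence (k : ℕ) (c d : NewConst) : treeLang.Sentence :=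
  (belowSymb k).boundedFormula₂ (constTerm c) (constTerm d)

/-- The axioms saying that `m ↦ c_{i,j,m}` is an isomorphism from `Mᵢ` onto the `L₀`-substructure
with domain `Cᵢʲ` (given that the constants are distinct). -/
def diagramAxioms : treeLang.Theory :=
  {φ | ∃ (i : FinModelType) (j k : ℕ) (m : Rep i),
      (OnLevel k m ∧ φ = levelSentence k ⟨i, j, m⟩) ∨
      (¬ OnLevel k m ∧ φ = (levelSentence k ⟨i, j, m⟩).not)} ∪
  {φ | ∃ (i : FinModelType) (j k : ℕ) (m m' : Rep i),
      (Below k m m' ∧ φ = belowSentence k ⟨i, j, m⟩ ⟨i, j, m'⟩) ∨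
      (¬ Below k m m' ∧ φ = (belowSentence k ⟨i, j, m⟩ ⟨i, j, m'⟩).not)}

/-- For all `x, y`: if `x ∈ Cᵢʲ` and (`x <ₖ y` or `y <ₖ x`), then `y ∈ Cᵢʲ`. -/
noncomputable def closureAx (i : FinModelType) (j k : ℕ) : treeLang.Sentence :=
  ∀' ∀' ((BoundedFormula.iSup (fun m : Rep i => (&0) =' constTerm ⟨i, j, m⟩) ⊓
      ((belowSymb k).boundedFormula₂ (&0) (&1) ⊔ (belowSymb k).boundedFormula₂ (&1) (&0))) ⟹
    BoundedFormula.iSup (fun m : Rep i => (&1) =' constTerm ⟨i, j, m⟩))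

/-- The theory `T`. -/
noncomputable def treeTheory : treeLang.Theory :=
  (forestLang.lhomWithConstants NewConst).onTheory forestTheory ∪
    forestLang.distinctConstantsTheory Set.univ ∪
    diagramAxioms ∪
    {φ | ∃ (i : FinModelType) (j k : ℕ), φ = closureAx i j k}

/-! ### The back-and-forth trees and the combined tree

Trees are prefix-closed sets of finite sequences; the children of `s` are the `s ++ [n]`. -/

/-- `backForth k` is the pair of back-and-forth trees `(E_{k+1}, A_{k+1})`. The tree `A₁` is a
single node and `E₁` a root with infinitely many leaves above it; `A_{k+2}` is a root with
infinitely many copies of `E_{k+1}` above it, and `E_{k+2}` a root with infinitely many copies of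
`A_{k+1}` and infinitely many copies of `E_{k+1}` above it. -/
def backForth : ℕ → Set (List ℕ) × Set (List ℕ)
  | 0 => ({[]} ∪ {s | ∃ n, s = [n]}, {[]})
  | k + 1 =>
    ({[]} ∪ {s | ∃ n, ∃ t ∈ (backForth k).2, s = (2 * n) :: t} ∪
        {s | ∃ n, ∃ t ∈ (backForth k).1, s = (2 * n + 1) :: t},
      {[]} ∪ {s | ∃ n, ∃ t ∈ (backForth k).1, s = n :: t})

/-- The leaf `F_{k+1}` of the combined tree, on level `2(k + 1)`. -/
def leafF (k : ℕ) : List ℕ := k :: List.replicate (2 * k + 1) 0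

/-- The node `G_{k+1}` of the combined tree, on level `2(k + 1)`; its predecessor is that of
`F_{k+1}`. -/
def nodeG (k : ℕ) : List ℕ := k :: List.replicate (2 * k) 0 ++ [1]

/-- The combined tree `N`: the root `F₀ = []`, for each `k` the nodes on the path to `F_{k+1}`
(these paths meet only in the root), and a copy of `E_{k+1}` with root `G_{k+1}`. -/
def combinedTree : Set (List ℕ) :=
  {s | ∃ k, s <+: leafF k} ∪ {s | ∃ k, ∃ t ∈ (backForth k).1, s = nodeG k ++ t}

/-- The combined tree as an `L₀`-structure. -/
instance combinedTreeStructure : forestLang.Structure combinedTree :=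
  mkForest (fun i s => s.1.length = i) (fun i s t => s.1.length = i ∧ ∃ n, t.1 = s.1 ++ [n])

/-- The `L₀`-structure on the constants: the disjoint union over all `i` and `j` of copies of the
finite models `Mᵢ`. -/
noncomputable instance constStructure : forestLang.Structure NewConst :=
  mkForest (fun k c => OnLevel k c.2.2)
    (fun k c d => ∃ (i : FinModelType) (j : ℕ) (m m' : Rep i),
      c = ⟨i, j, m⟩ ∧ d = ⟨i, j, m'⟩ ∧ Below k m m')

/-- The model `M`: the disjoint union of the constants and the combined tree. -/
abbrev BigModel : Type := NewConst ⊕ combinedTree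

/-- Each new constant names itself. -/
instance bigModelConstants : (constantsOn NewConst).Structure BigModel :=
  constantsOn.structure Sum.inl

theorem root_mem : [] ∈ combinedTree := Or.inl ⟨0, List.nil_prefix⟩

theorem nodeG_mem (k : ℕ) : nodeG k ∈ combinedTree :=
  Or.inr ⟨k, [], by cases k <;> simp [backForth], by simp⟩

/-- The root of the combined tree, as an element of the model. -/
def rootM : BigModel := Sum.inr ⟨[], root_mem⟩

/-- The node `G_{k+1}` as an element of the model. -/
def nodeGM (k : ℕ) : BigModel := Sum.inr ⟨nodeG k, nodeG_mem k⟩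

/-! ### Listings of the atomic sentences exist -/

/-- The models of `T₀`, spelled out. -/
theorem forestTheory_iff {M : Type} [forestLang.Structure M] :
    M ⊨ forestTheory ↔
      (∀ i j : ℕ, i ≠ j → ∀ a : M, ¬ (OnLevel i a ∧ OnLevel j a)) ∧
      (∀ (i : ℕ) (a b : M), Below i a b → OnLevel i a ∧ OnLevel (i + 1) b) ∧
      (∀ (i : ℕ) (a : M), OnLevel (i + 1) a → ∃ b : M, OnLevel i b ∧ Below i b a) ∧
      (∀ (i : ℕ) (a b c : M), Below i a c → Below i b c → a = b) := by
  have h1 : ∀ i j : ℕ, M ⊨ disjointAx i j ↔ ∀ a : M, ¬ (OnLevel i a ∧ OnLevel j a) := by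
    intro i j
    simp [disjointAx, Sentence.Realize, Formula.Realize, BoundedFormula.realize_rel₁, Fin.snoc]
  have h2 : ∀ i : ℕ, M ⊨ levelAx i ↔
      ∀ a b : M, Below i a b → OnLevel i a ∧ OnLevel (i + 1) b := by
    intro i
    simp [levelAx, Sentence.Realize, Formula.Realize, BoundedFormula.realize_rel₁,
      BoundedFormula.realize_rel₂, Fin.snoc]
  have h3 : ∀ i : ℕ, M ⊨ existsPredAx i ↔
      ∀ a : M, OnLevel (i + 1) a → ∃ b : M, OnLevel i b ∧ Below i b a := by
    intro i
    simp [existsPredAx, Sentence.Realize, Formula.Realize, BoundedFormula.realize_rel₁,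
      BoundedFormula.realize_rel₂, Fin.snoc]
  have h4 : ∀ i : ℕ, M ⊨ uniquePredAx i ↔
      ∀ a b c : M, Below i a c → Below i b c → a = b := by
    intro i
    simp [uniquePredAx, Sentence.Realize, Formula.Realize, BoundedFormula.realize_rel₂, Fin.snoc]
  constructor
  · intro h
    refine ⟨fun i j hij => (h1 i j).1 ?_, fun i => (h2 i).1 ?_, fun i => (h3 i).1 ?_,
      fun i => (h4 i).1 ?_⟩
    · exact h.realize_of_mem _ (Or.inl (Or.inl (Or.inl ⟨i, j, hij, rfl⟩)))
    · exact h.realize_of_mem _ (Or.inl (Or.inl (Or.inr ⟨i, rfl⟩)))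
    · exact h.realize_of_mem _ (Or.inl (Or.inr ⟨i, rfl⟩))
    · exact h.realize_of_mem _ (Or.inr ⟨i, rfl⟩)
  · rintro ⟨g1, g2, g3, g4⟩
    refine ⟨?_⟩
    rintro φ (((⟨i, j, hij, rfl⟩ | ⟨i, rfl⟩) | ⟨i, rfl⟩) | ⟨i, rfl⟩)
    · exact (h1 i j).2 (g1 i j hij)
    · exact (h2 i).2 (g2 i)
    · exact (h3 i).2 (g3 i)
    · exact (h4 i).2 (g4 i)

/-- There are only countably many finite models of `T₀` on initial segments of `ω`. -/
instance countableFinModel : Countable FinModel := by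
  have key : ∀ A : FinModel, letI := A.str
      {x : ℕ × Fin A.size | OnLevel x.1 x.2}.Finite ∧
      {x : ℕ × Fin A.size × Fin A.size | Below x.1 x.2.1 x.2.2}.Finite := by
    intro A
    let := A.str
    obtain ⟨g1, g2, -, -⟩ := forestTheory_iff.1 A.isModel
    constructor
    · refine Set.Finite.of_finite_image (f := Prod.snd) (Set.toFinite _) ?_
      rintro ⟨i, a⟩ hi ⟨j, b⟩ hj (rfl : a = b)
      by_contra hne
      exact g1 i j (fun h => hne (by rw [h])) a ⟨hi, hj⟩
    · refine Set.Finite.of_finite_image (f := Prod.snd) (Set.toFinite _) ?_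
      rintro ⟨i, a, a'⟩ hi ⟨j, b, b'⟩ hj hab
      obtain ⟨rfl, rfl⟩ := Prod.mk.inj hab
      by_contra hne
      exact g1 i j (fun h => hne (by rw [h])) a ⟨(g2 i _ _ hi).1, (g2 j _ _ hj).1⟩
  let F : FinModel → Σ n : ℕ, Finset (ℕ × Fin n) × Finset (ℕ × Fin n × Fin n) := fun A =>
    ⟨A.size, (key A).1.toFinset, (key A).2.toFinset⟩
  refine Function.Injective.countable (f := F) ?_
  rintro ⟨n, S, hS⟩ ⟨n', S', hS'⟩ h
  obtain rfl : n = n' := congrArg Sigma.fst h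
  obtain ⟨ha, hb⟩ := Prod.mk.inj (eq_of_heq (Sigma.mk.inj h).2)
  have ha' := fun x => Set.ext_iff.1 (Set.Finite.toFinset_inj.1 ha) x
  have hb' := fun x => Set.ext_iff.1 (Set.Finite.toFinset_inj.1 hb) x
  have : S = S' := by
    ext m r x
    · exact r.elim
    · cases r with
      | level i =>
        have hx : x = ![x 0] := by ext k; fin_cases k; rfl
        rw [hx]
        exact ha' (i, x 0)
      | below i =>
        have hx : x = ![x 0, x 1] := by ext k; fin_cases k <;> rfl
        rw [hx]
        exact hb' (i, x 0, x 1)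
  subst this
  rfl

instance countableForestLang : Countable forestLang.Symbols := by
  have : ∀ n, Countable (ForestRel n) := fun n => by
    refine Function.Injective.countable
      (f := fun r : ForestRel n => match r with | .level i => i | .below i => i) ?_
    intro r r' h
    cases r <;> cases r' <;> simp_all
  have : ∀ n, Countable (forestLang.Relations n) := this
  have : ∀ n, Countable (forestLang.Functions n) := fun n => inferInstanceAs (Countable Empty)
  exact inferInstanceAs (Countable ((Σ n, forestLang.Functions n) ⊕ (Σ n, forestLang.Relations n)))

/-- The atomic sentences over a countable language can be listed; in particular those of the
language of a `1`-type over `T`. -/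
theorem exists_listing :
    ∃ e : ℕ → AtomicSentence (treeLang[[Fin 1]]), Function.Surjective e := by
  have : Countable ((treeLang[[Fin 1]])[[ℕ]]).Sentence :=
    inferInstanceAs (Countable (((treeLang[[Fin 1]])[[ℕ]]).Formula Empty))
  have : Nonempty (AtomicSentence (treeLang[[Fin 1]])) :=
    ⟨⟨Term.bdEqual (Constants.term (FirstOrder.Language.con _ 0)) (Constants.term (FirstOrder.Language.con _ 0)),
      BoundedFormula.IsAtomic.equal _ _⟩⟩
  exact exists_surjective_nat _

end UnboundedType

open UnboundedType

namespace UnboundedType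

/-! The trees `E` and `A` code the finite Borel levels. For `U` in `Σ⁰_{k+1}` there is a family of
trees `T x`, varying continuously with `x`, such that `T x` is a copy of `E_{k+1}` if `x ∈ U` and of
`A_{k+1}` otherwise (`exists_family_isKind`). For an open `U`, leaves are added once a finite part
of `x` shows that `x ∈ U`. If `U = ⋃ tᵢ` with each complement `tᵢᶜ` one level lower, put above a
root infinitely many copies of `E` and, infinitely often for each `i`, the tree belonging to `tᵢᶜ`;
a copy of `A` occurs exactly when `x` lies in some `tᵢ`. The predicate `IsKind` leaves the positions
of the children free, and trees of the same kind are isomorphic (`IsKind.treeIso`).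

A `Π⁰_ω` set is `⋂ Sₖ` with `Sₖ` in `Σ⁰_{k+1}`. Graft the `k`-th tree above `G_{k+1}`, for all `k`
at once, and add the constants. If `x ∈ ⋂ Sₖ`, the result is isomorphic to `M` over the root, so the
root realizes `p`. If `x ∉ Sₖ`, a sentence of `p` fails: `F_{k+1}` and `G_{k+1}` are definable as
the children of the only node on level `2k+1` with exactly two children, and the first-order
property `Tall k` of the tree above a node separates `E_{k+1}` from `A_{k+1}` and from the leaf.
This is `model_rootType_iff`. Numbering the elements in the order of a fixed coding makes the copies
with domain `ω` depend continuously on `x`, which gives hardness.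

Along a continuous family of structures, a `∀ₙ`-sentence defines a set whose complement is
`Σ⁰_{n+1}`. If `p` were `∀ₙ`-axiomatizable, every set reducible to its models by such a family would
have a `Σ⁰_{n+1}` complement. But all `Σ⁰_{n+1}` sets are so reducible, and some of them have a
complement outside `Σ⁰_{n+1}`. -/

/-! ### Trees of finite sequences -/

/-- The part of the tree `T` above its node `[n]`. -/
def above (T : Set (List ℕ)) (n : ℕ) : Set (List ℕ) := {t | n :: t ∈ T}

@[simp] theorem mem_above {T : Set (List ℕ)} {n : ℕ} {t : List ℕ} :
    t ∈ above T n ↔ n :: t ∈ T := Iff.rfl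

/-- `IsKind true k T` says that `T` is a copy of `E_{k+1}`, and `IsKind false k T` that it is a
copy of `A_{k+1}`. -/
def IsKind : Bool → ℕ → Set (List ℕ) → Prop
  | false, 0, T => T = {[]}
  | true, 0, T => [] ∈ T ∧ {n | above T n = {[]}}.Infinite ∧
      ∀ n, above T n = ∅ ∨ above T n = {[]}
  | false, k + 1, T => [] ∈ T ∧ {n | IsKind true k (above T n)}.Infinite ∧
      ∀ n, above T n = ∅ ∨ IsKind true k (above T n)
  | true, k + 1, T => [] ∈ T ∧ {n | IsKind true k (above T n)}.Infinite ∧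
      {n | IsKind false k (above T n)}.Infinite ∧
      ∀ n, above T n = ∅ ∨ ∃ b, IsKind b k (above T n)

theorem IsKind.nil_mem {b : Bool} {k : ℕ} {T : Set (List ℕ)} (h : IsKind b k T) : [] ∈ T := by
  cases b <;> cases k <;> simp only [IsKind] at h
  · simp [h]
  all_goals exact h.1

/-- The shape common to all trees of a given kind. -/
theorem IsKind.rec_above {P : Set (List ℕ) → Prop} (h0 : P {[]})
    (hs : ∀ T : Set (List ℕ), [] ∈ T → {n | [n] ∈ T}.Infinite →
      (∀ n, above T n = ∅ ∨ P (above T n)) → P T)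
    {b : Bool} {k : ℕ} {T : Set (List ℕ)} (h : IsKind b k T) : P T := by
  induction k generalizing b T with
  | zero =>
    cases b
    · simp only [IsKind] at h
      rwa [h]
    · refine hs T h.1 (h.2.1.mono fun n hn => ?_) fun n => (h.2.2 n).imp id fun e => by rwa [e]
      have : [] ∈ above T n := by rw [hn]; rfl
      exact this
  | succ k ih =>
    cases b
    · exact hs T h.1 (h.2.1.mono fun n hn => IsKind.nil_mem hn)
        fun n => (h.2.2 n).imp id fun e => ih e
    · exact hs T h.1 (h.2.1.mono fun n hn => IsKind.nil_mem hn)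
        fun n => (h.2.2.2 n).imp id fun ⟨b, e⟩ => ih e

/-- `T` is closed under prefixes. -/
def PrefixClosed (T : Set (List ℕ)) : Prop := ∀ (s : List ℕ) (n : ℕ), s ++ [n] ∈ T → s ∈ T

theorem PrefixClosed.mem_of_prefix {T : Set (List ℕ)} (h : PrefixClosed T) {s t : List ℕ}
    (hst : s <+: t) (ht : t ∈ T) : s ∈ T := by
  obtain ⟨u, rfl⟩ := hst
  induction u using List.reverseRecOn with
  | nil => simpa using ht
  | append_singleton u n ih => exact ih (h _ n (by simpa using ht))

theorem PrefixClosed.dropLast_mem {T : Set (List ℕ)} (h : PrefixClosed T) {s : List ℕ}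
    (hs : s ∈ T) : s.dropLast ∈ T :=
  h.mem_of_prefix (List.dropLast_prefix s) hs

/-- No node of `T` has exactly two children. -/
def NoTwoChildren (T : Set (List ℕ)) : Prop :=
  ∀ (s : List ℕ) (m n : ℕ), m ≠ n → s ++ [m] ∈ T → s ++ [n] ∈ T →
    ∃ c, c ≠ m ∧ c ≠ n ∧ s ++ [c] ∈ T

theorem IsKind.prefixClosed {b : Bool} {k : ℕ} {T : Set (List ℕ)} (h : IsKind b k T) :
    PrefixClosed T := by
  refine h.rec_above (P := PrefixClosed) ?_ ?_
  · intro s n hs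
    simp at hs
  · rintro T h0 - hT (_ | ⟨a, s⟩) n hs
    · exact h0
    · obtain e | hP := hT a
      · have : s ++ [n] ∈ above T a := hs
        simp [e] at this
      · exact hP s n hs

/-- Each node has no child or infinitely many. Hence having exactly two children can mark the
predecessors of the `G_{k+1}`, whatever trees are grafted. -/
theorem IsKind.noTwoChildren {b : Bool} {k : ℕ} {T : Set (List ℕ)} (h : IsKind b k T) :
    NoTwoChildren T := by
  refine h.rec_above (P := NoTwoChildren) ?_ ?_
  · intro s m n _ hs
    simp at hs
  · rintro T - hinf hT (_ | ⟨a, s⟩) m n hmn hm hn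
    · obtain ⟨c, hc, hc'⟩ := hinf.exists_notMem_finset {m, n}
      simp only [Finset.mem_insert, Finset.mem_singleton, not_or] at hc'
      exact ⟨c, hc'.1, hc'.2, hc⟩
    · obtain e | hP := hT a
      · have : s ++ [m] ∈ above T a := hm
        simp [e] at this
      · exact hP s m n hmn hm hn

/-- The property that tells the copies of `E_{k+1}` from those of `A_{k+1}`. -/
def Tall : ℕ → Set (List ℕ) → Prop
  | 0, T => ∃ n, [n] ∈ T
  | k + 1, T => ∃ n, [n] ∈ T ∧ ¬ Tall k (above T n)

/-- All children of the root of `A_{k+2}` carry copies of `E_{k+1}`, while some child in `E_{k+2}`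
carries `A_{k+1}`; so having a child that is not tall separates the two kinds one step up. -/
theorem IsKind.tall_iff {b : Bool} {k : ℕ} {T : Set (List ℕ)} (h : IsKind b k T) :
    Tall k T ↔ b = true := by
  induction k generalizing b T with
  | zero =>
    cases b
    · simp only [IsKind] at h
      simp [Tall, h]
    · obtain ⟨n, hn⟩ := h.2.1.nonempty
      simp only [Tall, iff_true]
      have : [] ∈ above T n := by rw [hn]; rfl
      exact ⟨n, this⟩
  | succ k ih =>
    cases b
    · simp only [Tall, Bool.false_eq_true, iff_false, not_exists, not_and, not_not]
      intro n hn
      obtain e | e := h.2.2 n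
      · have : [] ∈ above T n := hn
        simp [e] at this
      · exact (ih e).2 rfl
    · obtain ⟨n, hn⟩ := h.2.2.1.nonempty
      simp only [Tall, iff_true]
      exact ⟨n, IsKind.nil_mem hn, fun ht => by simpa using (ih hn).1 ht⟩

/-! ### Isomorphisms of trees -/

/-- The trees `S` and `T` are isomorphic. -/
def TreeIso (S T : Set (List ℕ)) : Prop :=
  ∃ f : List ℕ → List ℕ, Set.BijOn f S T ∧
    ∀ s ∈ S, (f s).length = s.length ∧ f s.dropLast = (f s).dropLast

theorem TreeIso.refl (T : Set (List ℕ)) : TreeIso T T :=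
  ⟨id, Set.bijOn_id T, fun _ _ => ⟨rfl, rfl⟩⟩

/-- A matching `σ` of the children of the roots and isomorphisms between the matched subtrees glue
to an isomorphism. -/
theorem TreeIso.of_above {S T : Set (List ℕ)} (hS : [] ∈ S) (hT : [] ∈ T)
    {σ : ℕ → ℕ} (hσ : Set.BijOn σ {n | (above S n).Nonempty} {n | (above T n).Nonempty})
    (h : ∀ n, (above S n).Nonempty → TreeIso (above S n) (above T (σ n))) : TreeIso S T := by
  have h' : ∀ n, ∃ f : List ℕ → List ℕ, (above S n).Nonempty →
      Set.BijOn f (above S n) (above T (σ n)) ∧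
        ∀ s ∈ above S n, (f s).length = s.length ∧ f s.dropLast = (f s).dropLast := by
    intro n
    by_cases hn : (above S n).Nonempty
    · obtain ⟨f, hf⟩ := h n hn
      exact ⟨f, fun _ => hf⟩
    · exact ⟨id, fun h => absurd h hn⟩
  choose f hf using h'
  let g : List ℕ → List ℕ := fun s => match s with
    | [] => []
    | n :: t => σ n :: f n t
  have hne : ∀ {U : Set (List ℕ)} {n t}, n :: t ∈ U → (above U n).Nonempty := fun ht => ⟨_, ht⟩
  refine ⟨g, ⟨?_, ?_, ?_⟩, ?_⟩
  · rintro (_ | ⟨n, t⟩) hs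
    · exact hT
    · exact (hf n (hne hs)).1.mapsTo hs
  · rintro (_ | ⟨n, t⟩) hs (_ | ⟨m, u⟩) hu hsu
    · rfl
    · simp [g] at hsu
    · simp [g] at hsu
    · simp only [g, List.cons.injEq] at hsu
      obtain rfl := hσ.injOn (hne hs) (hne hu) hsu.1
      rw [(hf n (hne hs)).1.injOn hs hu hsu.2]
  · rintro (_ | ⟨n, t⟩) ht
    · exact ⟨[], hS, rfl⟩
    · obtain ⟨m, hm, rfl⟩ := hσ.surjOn (hne ht)
      obtain ⟨u, hu, rfl⟩ := (hf m hm).1.surjOn ht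
      exact ⟨m :: u, hu, rfl⟩
  · rintro (_ | ⟨n, t⟩) hs
    · simp [g]
    · obtain ⟨h1, h2⟩ := (hf n (hne hs)).2 t hs
      refine ⟨by simp [g, h1], ?_⟩
      cases t with
      | nil =>
        have : f n [] = [] := by simpa using h1
        simp [g, this]
      | cons a t =>
        have hne' : f n (a :: t) ≠ [] := fun e => by simp [e] at h1
        rw [List.dropLast_cons_of_ne_nil (by simp)]
        simp only [g]
        rw [List.dropLast_cons_of_ne_nil hne', h2]

theorem exists_bijOn_of_infinite {A B : Set ℕ} (hA : A.Infinite) (hB : B.Infinite) :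
    ∃ f : ℕ → ℕ, Set.BijOn f A B := by
  have := hA.to_subtype
  have := hB.to_subtype
  obtain ⟨e⟩ : Nonempty (A ≃ B) := nonempty_equiv_of_countable
  classical
  refine ⟨fun n => if h : n ∈ A then e ⟨n, h⟩ else 0, ?_, ?_, ?_⟩
  · intro n hn
    simp [hn]
  · intro m hm n hn hmn
    simp only [hm, hn, dif_pos] at hmn
    simpa using e.injective (Subtype.ext hmn)
  · intro m hm
    refine ⟨e.symm ⟨m, hm⟩, Subtype.coe_prop _, ?_⟩
    simp

/-- Bijections between the colour classes of two subsets of `ℕ` glue. -/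
theorem exists_bijOn_of_colours {A B : Set ℕ} {c d : ℕ → Prop}
    (h₁ : ∃ f : ℕ → ℕ, Set.BijOn f {n ∈ A | c n} {n ∈ B | d n})
    (h₂ : ∃ f : ℕ → ℕ, Set.BijOn f {n ∈ A | ¬ c n} {n ∈ B | ¬ d n}) :
    ∃ f : ℕ → ℕ, Set.BijOn f A B ∧ ∀ n ∈ A, d (f n) ↔ c n := by
  classical
  obtain ⟨f, hf⟩ := h₁
  obtain ⟨g, hg⟩ := h₂
  have key : ∀ n ∈ A, (if c n then f n else g n) ∈ B ∧ (d (if c n then f n else g n) ↔ c n) := by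
    intro n hn
    by_cases h : c n
    · have := hf.mapsTo (show n ∈ {n ∈ A | c n} from ⟨hn, h⟩)
      simpa [h] using this
    · have := hg.mapsTo (show n ∈ {n ∈ A | ¬ c n} from ⟨hn, h⟩)
      simpa [h] using this
  refine ⟨fun n => if c n then f n else g n, ⟨fun n hn => (key n hn).1, ?_, ?_⟩,
    fun n hn => (key n hn).2⟩
  · intro m hm n hn hmn
    -- Equal images have equal colours, so both points were mapped by the same one of the two
    -- bijections.
    have e : c m ↔ c n := by
      rw [← (key m hm).2, ← (key n hn).2]
      exact iff_of_eq (congrArg d hmn)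
    by_cases h : c m
    · have h' := e.1 h
      simp only [h, h', if_true] at hmn
      exact hf.injOn ⟨hm, h⟩ ⟨hn, h'⟩ hmn
    · have h' : ¬ c n := fun x => h (e.2 x)
      simp only [h, h', if_false] at hmn
      exact hg.injOn ⟨hm, h⟩ ⟨hn, h'⟩ hmn
  · intro n hn
    by_cases h : d n
    · obtain ⟨m, hm, rfl⟩ := hf.surjOn (show n ∈ {n ∈ B | d n} from ⟨hn, h⟩)
      exact ⟨m, hm.1, by simp [hm.2]⟩
    · obtain ⟨m, hm, rfl⟩ := hg.surjOn (show n ∈ {n ∈ B | ¬ d n} from ⟨hn, h⟩)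
      exact ⟨m, hm.1, by simp [hm.2]⟩

theorem nonempty_of_isKind {b : Bool} {k : ℕ} {T : Set (List ℕ)} (h : IsKind b k T) :
    T.Nonempty := ⟨[], h.nil_mem⟩

/-- Two trees of the same kind are isomorphic. -/
theorem IsKind.treeIso {b : Bool} {k : ℕ} {S T : Set (List ℕ)} (hS : IsKind b k S)
    (hT : IsKind b k T) : TreeIso S T := by
  induction k generalizing b S T with
  | zero =>
    cases b
    · simp only [IsKind] at hS hT
      rw [hS, hT]
      exact .refl _
    · have key : ∀ {U : Set (List ℕ)}, IsKind true 0 U → ∀ n, (above U n).Nonempty →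
          above U n = {[]} := fun hU n hn => (hU.2.2 n).resolve_left hn.ne_empty
      have key' : ∀ {U : Set (List ℕ)}, IsKind true 0 U → {n | (above U n).Nonempty}.Infinite :=
        fun hU => hU.2.1.mono fun n hn => by
          change above _ n = _ at hn
          change (above _ n).Nonempty
          simp [hn]
      obtain ⟨σ, hσ⟩ := exists_bijOn_of_infinite (key' hS) (key' hT)
      refine .of_above hS.nil_mem hT.nil_mem hσ fun n hn => ?_
      rw [key hS n hn, key hT (σ n) (hσ.mapsTo hn)]
      exact .refl _
  | succ k ih =>
    have key : ∀ {U : Set (List ℕ)}, IsKind b (k + 1) U → ∀ n, (above U n).Nonempty →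
        ∃ b', IsKind b' k (above U n) := by
      intro U hU n hn
      cases b
      · exact ⟨true, (hU.2.2 n).resolve_left hn.ne_empty⟩
      · exact (hU.2.2.2 n).resolve_left hn.ne_empty
    -- Colour the children by `Tall k`, that is, by their kind. The tall class is infinite; the
    -- other one is empty for `A` and infinite for `E`. So the children can be matched with colours
    -- preserved.
    have hc : ∀ {U : Set (List ℕ)}, IsKind b (k + 1) U →
        {n ∈ {n | (above U n).Nonempty} | Tall k (above U n)}.Infinite := by
      intro U hU
      have : {n | IsKind true k (above U n)}.Infinite := by
        cases b
        · exact hU.2.1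
        · exact hU.2.1
      exact this.mono fun n hn => ⟨nonempty_of_isKind hn, (IsKind.tall_iff hn).2 rfl⟩
    obtain ⟨σ, hσ, hσ'⟩ := exists_bijOn_of_colours
      (A := {n | (above S n).Nonempty}) (B := {n | (above T n).Nonempty})
      (c := fun n => Tall k (above S n)) (d := fun n => Tall k (above T n))
      (exists_bijOn_of_infinite (hc hS) (hc hT)) (by
        cases b
        · have : ∀ {U : Set (List ℕ)}, IsKind false (k + 1) U →
              {n ∈ {n | (above U n).Nonempty} | ¬ Tall k (above U n)} = ∅ := by
            intro U hU
            refine Set.eq_empty_iff_forall_notMem.2 fun n hn => hn.2 ?_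
            exact (IsKind.tall_iff ((hU.2.2 n).resolve_left hn.1.ne_empty)).2 rfl
          rw [this hS, this hT]
          exact ⟨id, Set.bijOn_id _⟩
        · have : ∀ {U : Set (List ℕ)}, IsKind true (k + 1) U →
              {n ∈ {n | (above U n).Nonempty} | ¬ Tall k (above U n)}.Infinite := fun hU =>
            hU.2.2.1.mono fun n hn => ⟨nonempty_of_isKind hn, fun h => by
              simpa using (IsKind.tall_iff hn).1 h⟩
          exact exists_bijOn_of_infinite (this hS) (this hT))
    refine .of_above hS.nil_mem hT.nil_mem hσ fun n hn => ?_
    obtain ⟨b₁, h₁⟩ := key hS n hn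
    obtain ⟨b₂, h₂⟩ := key hT (σ n) (hσ.mapsTo hn)
    have : b₁ = b₂ := by
      have := hσ' n hn
      rw [h₁.tall_iff, h₂.tall_iff] at this
      exact (Bool.eq_iff_iff.2 this).symm
    subst this
    exact ih h₁ h₂

/-! ### The trees `E_{k+1}` and `A_{k+1}` -/

/-- The tree with root `[]` in which the tree above `[n]` is `Q n`. -/
def join (Q : ℕ → Set (List ℕ)) : Set (List ℕ) :=
  {s | s = [] ∨ ∃ n, ∃ t ∈ Q n, s = n :: t}

@[simp] theorem nil_mem_join (Q : ℕ → Set (List ℕ)) : [] ∈ join Q := Or.inl rfl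

@[simp] theorem cons_mem_join {Q : ℕ → Set (List ℕ)} {n : ℕ} {t : List ℕ} :
    n :: t ∈ join Q ↔ t ∈ Q n := by
  constructor
  · rintro (h | ⟨m, u, hu, h⟩)
    · simp at h
    · obtain ⟨rfl, rfl⟩ := List.cons.inj h
      exact hu
  · exact fun h => Or.inr ⟨n, t, h, rfl⟩

@[simp] theorem above_join (Q : ℕ → Set (List ℕ)) (n : ℕ) : above (join Q) n = Q n := by
  ext t
  simp

theorem isKind_backForth (k : ℕ) :
    IsKind true k (backForth k).1 ∧ IsKind false k (backForth k).2 := by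
  induction k with
  | zero =>
    have h : (backForth 0).1 = join fun _ => {[]} := by
      ext s
      cases s <;> simp [backForth]
    refine ⟨?_, rfl⟩
    rw [h]
    refine ⟨by simp, ?_, by simp⟩
    simpa using Set.infinite_univ
  | succ k ih =>
    -- Even positions carry the copies of `A_{k+1}`, odd ones those of `E_{k+1}`.
    have h₁ : (backForth (k + 1)).1 =
        join fun n => if Even n then (backForth k).2 else (backForth k).1 := by
      ext s
      rcases s with - | ⟨m, s⟩
      · simp [backForth]
      · rw [cons_mem_join]
        simp only [backForth, Set.mem_union, Set.mem_singleton_iff, reduceCtorEq, false_or,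
          Set.mem_ofPred_eq, List.cons.injEq]
        split_ifs with hm
        · obtain ⟨r, rfl⟩ := hm.two_dvd
          constructor
          · rintro (⟨n, t, ht, -, rfl⟩ | ⟨n, t, ht, h, rfl⟩)
            · exact ht
            · omega
          · exact fun hs => Or.inl ⟨r, s, hs, rfl, rfl⟩
        · obtain ⟨r, rfl⟩ := Nat.not_even_iff_odd.1 hm
          constructor
          · rintro (⟨n, t, ht, h, rfl⟩ | ⟨n, t, ht, -, rfl⟩)
            · omega
            · exact ht
          · exact fun hs => Or.inr ⟨r, s, hs, rfl, rfl⟩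
    have h₂ : (backForth (k + 1)).2 = join fun _ => (backForth k).1 := by
      ext s
      rcases s with - | ⟨m, s⟩
      · simp [backForth]
      · rw [cons_mem_join]
        simp [backForth]
    rw [h₁, h₂]
    refine ⟨⟨by simp, ?_, ?_, ?_⟩, by simp, ?_, ?_⟩
    · refine Set.infinite_of_injective_forall_mem (f := fun n : ℕ => 2 * n + 1)
        (fun a b h => by simpa using h) fun n => ?_
      simpa [above_join] using ih.1
    · refine Set.infinite_of_injective_forall_mem (f := fun n : ℕ => 2 * n)
        (fun a b h => by simpa using h) fun n => ?_
      simpa [above_join] using ih.2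
    · intro n
      right
      rw [above_join]
      split_ifs
      · exact ⟨false, ih.2⟩
      · exact ⟨true, ih.1⟩
    · simpa [ih.1] using Set.infinite_univ
    · simp [ih.1]

/-! ### Grafting trees on the nodes `G_{k+1}` -/

theorem TreeIso.join_congr {Q Q' : ℕ → Set (List ℕ)} (h : ∀ n, TreeIso (Q n) (Q' n)) :
    TreeIso (join Q) (join Q') := by
  have h' : ∀ n, (Q n).Nonempty ↔ (Q' n).Nonempty := by
    intro n
    obtain ⟨f, hf, -⟩ := h n
    rw [← hf.image_eq, Set.image_nonempty]
  refine .of_above (σ := id) (by simp) (by simp) ?_ ?_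
  · simp only [above_join, h']
    exact Set.bijOn_id _
  · intro n _
    simpa using h n

theorem PrefixClosed.join {Q : ℕ → Set (List ℕ)} (h : ∀ n, PrefixClosed (Q n)) :
    PrefixClosed (join Q) := by
  rintro (_ | ⟨n, s⟩) m hs
  · simp
  · simpa using h n s m (by simpa using hs)

/-- The tree with a leaf at `[0]` and the tree `R` above `[1]`. -/
def fork (R : Set (List ℕ)) : Set (List ℕ) :=
  join fun n => if n = 0 then {[]} else if n = 1 then R else ∅

/-- A non-branching path of length `m`, followed by `fork R`. -/
def stem (R : Set (List ℕ)) : ℕ → Set (List ℕ)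
  | 0 => fork R
  | m + 1 => join fun n => if n = 0 then stem R m else ∅

/-- The combined tree with an arbitrary tree `Q k` above `G_{k+1}`. -/
def graft (Q : ℕ → Set (List ℕ)) : Set (List ℕ) := join fun k => stem (Q k) (2 * k)

theorem nil_mem_fork (R : Set (List ℕ)) : [] ∈ fork R := nil_mem_join _

theorem nil_mem_stem (R : Set (List ℕ)) (m : ℕ) : [] ∈ stem R m := by
  cases m <;> exact nil_mem_join _

theorem mem_fork {R : Set (List ℕ)} {s : List ℕ} :
    s ∈ fork R ↔ s = [] ∨ s = [0] ∨ ∃ t ∈ R, s = 1 :: t := by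
  rcases s with - | ⟨_ | _ | n, s⟩ <;> simp [fork]

theorem mem_stem {R : Set (List ℕ)} {m : ℕ} {s : List ℕ} :
    s ∈ stem R m ↔ s <+: List.replicate (m + 1) 0 ∨
      ∃ t ∈ R, s = List.replicate m 0 ++ 1 :: t := by
  induction m generalizing s with
  | zero =>
    rw [stem, mem_fork]
    rcases s with - | ⟨_ | _ | n, s⟩ <;> simp [List.cons_prefix_cons, List.prefix_nil]
  | succ m ih =>
    rcases s with - | ⟨_ | n, s⟩
    · simp [nil_mem_stem]
    · rw [stem, cons_mem_join, if_pos rfl, ih, List.replicate_succ (n := m + 1),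
        List.cons_prefix_cons, List.replicate_succ (n := m)]
      simp
    · rw [stem, cons_mem_join, if_neg (by simp)]
      simp [List.replicate_succ, List.cons_prefix_cons]

/-- In the recursive form the trees above the nodes `G_{k+1}` are parameters, which can be replaced
by trees depending on a point. -/
theorem combinedTree_eq_graft : combinedTree = graft fun k => (backForth k).1 := by
  ext s
  rcases s with - | ⟨k, s⟩
  · simp [graft, root_mem]
  · rw [graft, cons_mem_join, mem_stem]
    simp only [combinedTree, leafF, nodeG, Set.mem_union, Set.mem_ofPred_eq,
      List.cons_prefix_cons, List.cons_append, List.cons.injEq, List.append_assoc, List.nil_append]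
    constructor
    · rintro (⟨j, rfl, h⟩ | ⟨j, t, ht, rfl, h⟩)
      · exact Or.inl h
      · exact Or.inr ⟨t, ht, h⟩
    · rintro (h | ⟨t, ht, h⟩)
      · exact Or.inl ⟨k, rfl, h⟩
      · exact Or.inr ⟨k, t, ht, rfl, h⟩

theorem TreeIso.graft_congr {Q Q' : ℕ → Set (List ℕ)} (h : ∀ n, TreeIso (Q n) (Q' n)) :
    TreeIso (graft Q) (graft Q') := by
  have h0 : ∀ k, TreeIso (fork (Q k)) (fork (Q' k)) := fun k => .join_congr fun n => by
    split_ifs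
    exacts [.refl _, h k, .refl _]
  refine .join_congr fun k => ?_
  induction 2 * k with
  | zero => exact h0 k
  | succ m ih =>
    refine .join_congr fun n => ?_
    split_ifs
    exacts [ih, .refl _]

theorem prefixClosed_graft {Q : ℕ → Set (List ℕ)} (h : ∀ k, PrefixClosed (Q k)) :
    PrefixClosed (graft Q) := by
  have hs : PrefixClosed ({[]} : Set (List ℕ)) := fun s n hs => by simp at hs
  have he : PrefixClosed (∅ : Set (List ℕ)) := fun s n hs => by simp at hs
  refine .join fun k => ?_
  induction 2 * k with
  | zero =>
    refine .join fun n => ?_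
    split_ifs
    exacts [hs, h k, he]
  | succ m ih =>
    refine .join fun n => ?_
    split_ifs
    exacts [ih, he]

/-! ### The nodes with exactly two children -/

/-- The common predecessor of `F_{k+1}` and `G_{k+1}`. -/
def baseNode (k : ℕ) : List ℕ := k :: List.replicate (2 * k) 0

theorem length_baseNode (k : ℕ) : (baseNode k).length = 2 * k + 1 := by simp [baseNode]

theorem leafF_eq (k : ℕ) : leafF k = baseNode k ++ [0] := by
  simp [leafF, baseNode, List.replicate_succ']

theorem nodeG_eq (k : ℕ) : nodeG k = baseNode k ++ [1] := rfl

theorem baseNode_append_mem {Q : ℕ → Set (List ℕ)} {k : ℕ} {t : List ℕ} :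
    baseNode k ++ t ∈ graft Q ↔ t ∈ fork (Q k) := by
  rw [graft, baseNode, List.cons_append, cons_mem_join]
  induction 2 * k with
  | zero => rfl
  | succ m ih => rw [List.replicate_succ, List.cons_append, stem, cons_mem_join, if_pos rfl, ih]

theorem nodeG_append_mem {Q : ℕ → Set (List ℕ)} {k : ℕ} {t : List ℕ} :
    nodeG k ++ t ∈ graft Q ↔ t ∈ Q k := by
  rw [nodeG_eq, List.append_assoc, baseNode_append_mem, mem_fork]
  simp

theorem leafF_append_mem {Q : ℕ → Set (List ℕ)} {k : ℕ} {t : List ℕ} :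
    leafF k ++ t ∈ graft Q ↔ t = [] := by
  rw [leafF_eq, List.append_assoc, baseNode_append_mem, mem_fork]
  simp

/-- The node `s` of `T` has exactly two children. -/
def ExactlyTwo (T : Set (List ℕ)) (s : List ℕ) : Prop :=
  ∃ m n, m ≠ n ∧ s ++ [m] ∈ T ∧ s ++ [n] ∈ T ∧ ∀ c, s ++ [c] ∈ T → c = m ∨ c = n

theorem NoTwoChildren.not_exactlyTwo {T : Set (List ℕ)} (h : NoTwoChildren T) (s : List ℕ) :
    ¬ ExactlyTwo T s := by
  rintro ⟨m, n, hmn, hm, hn, hc⟩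
  obtain ⟨c, h1, h2, h3⟩ := h s m n hmn hm hn
  exact (hc c h3).elim h1 h2

theorem exactlyTwo_baseNode {Q : ℕ → Set (List ℕ)} {k : ℕ} (h : [] ∈ Q k) :
    ExactlyTwo (graft Q) (baseNode k) := by
  refine ⟨0, 1, by simp, ?_, ?_, fun c hc => ?_⟩
  · simp [baseNode_append_mem, mem_fork]
  · simpa [baseNode_append_mem, mem_fork] using h
  · rw [baseNode_append_mem, mem_fork] at hc
    simp at hc
    tauto

/-- The root has infinitely many children, a path node before the fork has one, a leaf none, and
inside the grafted trees `hQ` applies; only the forks are left. -/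
theorem exists_eq_baseNode {Q : ℕ → Set (List ℕ)} (hQ : ∀ k, NoTwoChildren (Q k)) {s : List ℕ}
    (h : ExactlyTwo (graft Q) s) : ∃ k, s = baseNode k := by
  have hj : ∀ {U : ℕ → Set (List ℕ)} {n t}, ExactlyTwo (join U) (n :: t) → ExactlyTwo (U n) t := by
    rintro U n t ⟨a, b, hab, ha, hb, hc⟩
    simp only [List.cons_append, cons_mem_join] at ha hb hc
    exact ⟨a, b, hab, ha, hb, hc⟩
  have hsingle : ∀ t, ¬ ExactlyTwo ({[]} : Set (List ℕ)) t := by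
    rintro t ⟨a, b, -, ha, -⟩
    simp at ha
  have hempty : ∀ t, ¬ ExactlyTwo (∅ : Set (List ℕ)) t := by
    rintro t ⟨a, b, -, ha, -⟩
    simp at ha
  have hfork : ∀ k t, ExactlyTwo (fork (Q k)) t → t = [] := by
    rintro k (_ | ⟨n, t⟩) ht
    · rfl
    · have := hj ht
      split_ifs at this
      exacts [(hsingle _ this).elim, ((hQ k).not_exactlyTwo _ this).elim, (hempty _ this).elim]
  have hstem : ∀ k m t, ExactlyTwo (stem (Q k) m) t → t = List.replicate m 0 := by
    intro k m
    induction m with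
    | zero => exact hfork k
    | succ m ih =>
      rintro (_ | ⟨n, t⟩) ht
      · obtain ⟨a, b, hab, ha, hb, -⟩ := ht
        simp only [stem, List.nil_append, cons_mem_join] at ha hb
        split_ifs at ha hb
        · omega
        all_goals simp_all
      · have := hj ht
        split_ifs at this with hn
        · rw [ih t this, hn, List.replicate_succ]
        · exact (hempty _ this).elim
  rcases s with - | ⟨k, s⟩
  · obtain ⟨a, b, hab, -, -, hc⟩ := h
    -- Every `[k]` is a child of the root, and `a + b + 1` differs from both `a` and `b`.
    have := hc (a + b + 1) (by simp [graft, nil_mem_stem])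
    omega
  · exact ⟨k, by rw [hstem k _ s (hj (U := fun k => stem (Q k) (2 * k)) h), baseNode]⟩

/-! ### The finite levels of the Borel hierarchy -/

section

variable {X Y : Type*} [TopologicalSpace X] [TopologicalSpace Y]

theorem boldSigma_of_isClopen {s : Set X} (hs : IsClopen s) (n : ℕ) : s ∈ boldSigma (n + 1) := by
  induction n generalizing s with
  | zero => exact hs.isOpen
  | succ n ih => exact ⟨fun _ => s, fun _ => ih hs.compl, (Set.iUnion_const s).symm⟩

theorem boldSigma_of_compl {s : Set X} {n : ℕ} (hs : sᶜ ∈ boldSigma (n + 1)) :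
    s ∈ boldSigma (n + 2) :=
  ⟨fun _ => s, fun _ => hs, (Set.iUnion_const s).symm⟩

theorem boldSigma_iUnion {ι : Type*} [Countable ι] {n : ℕ} {t : ι → Set X}
    (h : ∀ i, t i ∈ boldSigma (n + 1)) : ⋃ i, t i ∈ boldSigma (n + 1) := by
  cases n with
  | zero => exact isOpen_iUnion h
  | succ n =>
    cases isEmpty_or_nonempty ι
    · rw [Set.iUnion_of_empty]
      exact boldSigma_of_isClopen isClopen_empty _
    · choose u hu hu' using h
      obtain ⟨g, hg⟩ := exists_surjective_nat (ι × ℕ)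
      refine ⟨fun m => u (g m).1 (g m).2, fun m => hu _ _, ?_⟩
      rw [hg.iUnion_comp fun p : ι × ℕ => u p.1 p.2, Set.iUnion_prod']
      exact Set.iUnion_congr hu'

theorem boldSigma_preimage {f : X → Y} (hf : Continuous f) {n : ℕ} {s : Set Y}
    (hs : s ∈ boldSigma (n + 1)) : f ⁻¹' s ∈ boldSigma (n + 1) := by
  induction n generalizing s with
  | zero => exact hs.preimage hf
  | succ n ih =>
    obtain ⟨t, ht, rfl⟩ := hs
    exact ⟨fun i => f ⁻¹' t i, fun i => ih (ht i), Set.preimage_iUnion⟩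

theorem boldPiOmega_of_boldSigma {s : Set X} {n : ℕ} (hs : s ∈ boldSigma (n + 1)) :
    s ∈ boldPiOmega :=
  ⟨fun _ => s, fun _ => ⟨n + 1, by omega, hs⟩, (Set.iInter_const s).symm⟩

end

/-- The points `x` such that `U` contains every point that agrees with `x` on the first `m`
coordinates. -/
def clopenApprox (U : Set (ℕ → Bool)) (m : ℕ) : Set (ℕ → Bool) :=
  {x | ∀ y : ℕ → Bool, (∀ i < m, y i = x i) → y ∈ U}

theorem eventually_agree (x : ℕ → Bool) (m : ℕ) : ∀ᶠ y in nhds x, ∀ i < m, y i = x i := by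
  refine (Filter.eventually_all_finite (Set.finite_lt_nat m)).2 fun i _ => ?_
  exact ((continuous_apply i).tendsto x).eventually
    (p := fun b => b = x i) (IsOpen.mem_nhds (isOpen_discrete {x i}) rfl)

theorem isClopen_of_eventually {X : Type*} [TopologicalSpace X] {s : Set X}
    (h : ∀ x, ∀ᶠ y in nhds x, y ∈ s ↔ x ∈ s) : IsClopen s := by
  refine ⟨isOpen_compl_iff.1 (isOpen_iff_mem_nhds.2 fun x hx => ?_),
    isOpen_iff_mem_nhds.2 fun x hx => ?_⟩
  · filter_upwards [h x] with y hy
    exact fun hys => hx (hy.1 hys)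
  · filter_upwards [h x] with y hy
    exact hy.2 hx

theorem eventually_of_isClopen {X : Type*} [TopologicalSpace X] {s : Set X} (h : IsClopen s)
    (x : X) : ∀ᶠ y in nhds x, y ∈ s ↔ x ∈ s := by
  by_cases hx : x ∈ s
  · filter_upwards [h.isOpen.mem_nhds hx] with y hy
    simp [hx, hy]
  · filter_upwards [h.compl.isOpen.mem_nhds hx] with y hy
    simpa [hx] using hy

theorem isClopen_clopenApprox (U : Set (ℕ → Bool)) (m : ℕ) : IsClopen (clopenApprox U m) := by
  refine isClopen_of_eventually fun x => ?_
  filter_upwards [eventually_agree x m] with y hy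
  refine forall_congr' fun z => imp_congr (forall₂_congr fun i hi => ?_) Iff.rfl
  rw [hy i hi]

theorem clopenApprox_subset (U : Set (ℕ → Bool)) (m : ℕ) : clopenApprox U m ⊆ U :=
  fun x hx => hx x fun _ _ => rfl

theorem clopenApprox_mono (U : Set (ℕ → Bool)) : Monotone (clopenApprox U) :=
  fun _ _ h _ hx y hy => hx y fun i hi => hy i (hi.trans_le h)

theorem exists_mem_clopenApprox {U : Set (ℕ → Bool)} (hU : IsOpen U) {x : ℕ → Bool}
    (hx : x ∈ U) : ∃ m, x ∈ clopenApprox U m := by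
  obtain ⟨I, u, hu, hIU⟩ := isOpen_pi_iff.1 hU x hx
  refine ⟨I.sup id + 1, fun y hy => hIU fun i hi => ?_⟩
  rw [hy i (Nat.lt_succ_of_le (Finset.le_sup (f := id) hi))]
  exact (hu i hi).2

theorem iUnion_clopenApprox {U : Set (ℕ → Bool)} (hU : IsOpen U) :
    U = ⋃ m, clopenApprox U m := by
  refine Set.Subset.antisymm (fun x hx => ?_)
    (Set.iUnion_subset fun m => clopenApprox_subset U m)
  exact Set.mem_iUnion.2 (exists_mem_clopenApprox hU hx)

/-- Only the passage from level `1` to `2` uses the space: an open set is a countable union of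
clopen sets. Higher up the inclusion is inherited by the sets being united. -/
theorem boldSigma_mono {m n : ℕ} (hmn : m ≤ n) {U : Set (ℕ → Bool)}
    (hU : U ∈ boldSigma (m + 1)) : U ∈ boldSigma (n + 1) := by
  have step : ∀ (m : ℕ) (U : Set (ℕ → Bool)), U ∈ boldSigma (m + 1) → U ∈ boldSigma (m + 2) := by
    intro m
    induction m with
    | zero =>
      intro U hU
      exact ⟨clopenApprox U, fun i => (isClopen_clopenApprox U i).compl.isOpen,
        iUnion_clopenApprox hU⟩
    | succ m ih =>
      rintro U ⟨t, ht, rfl⟩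
      exact ⟨t, fun i => ih _ (ht i), rfl⟩
  induction hmn with
  | refl => exact hU
  | step _ ih => exact step _ _ ih

/-! ### Universal sets and strictness of the hierarchy -/

/-- Every level of the finite Borel hierarchy of Cantor space has universal sets. -/
theorem exists_universal (n : ℕ) : ∃ W : Set ((ℕ → Bool) × (ℕ → Bool)), W ∈ boldSigma (n + 1) ∧
    ∀ U : Set (ℕ → Bool), U ∈ boldSigma (n + 1) → ∃ c, U = {x | (c, x) ∈ W} := by
  induction n with
  | zero =>
    obtain ⟨B, hBc, -, hB⟩ := TopologicalSpace.exists_countable_basis (ℕ → Bool)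
    have hBne : B.Nonempty := by
      by_contra h
      rw [Set.not_nonempty_iff_eq_empty] at h
      obtain ⟨u, hu, -⟩ := hB.mem_nhds_iff.1 (Filter.univ_mem (f := nhds (fun _ : ℕ => true)))
      simp [h] at hu
    obtain ⟨b, rfl⟩ := hBc.exists_eq_range hBne
    -- The first coordinate selects which basic open sets are united.
    refine ⟨⋃ i, {p | p.1 i = true ∧ p.2 ∈ b i}, ?_, fun U hU => ?_⟩
    · rw [zero_add, boldSigma]
      refine isOpen_iUnion fun i => IsOpen.inter ?_ ((hB.isOpen ⟨i, rfl⟩).preimage continuous_snd)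
      exact (isOpen_discrete ({true} : Set Bool)).preimage
        (f := fun p : (ℕ → Bool) × (ℕ → Bool) => p.1 i)
        ((continuous_apply i).comp continuous_fst)
    · classical
      refine ⟨fun i => decide (b i ⊆ U), Set.ext fun x => ?_⟩
      simp only [Set.mem_iUnion, Set.mem_ofPred_eq, decide_eq_true_eq]
      constructor
      · intro hx
        obtain ⟨_, ⟨i, rfl⟩, hxi, hi⟩ := hB.mem_nhds_iff.1 (IsOpen.mem_nhds hU hx)
        exact ⟨i, hi, hxi⟩
      · rintro ⟨i, hi, hx⟩
        exact hi hx
  | succ n ih =>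
    obtain ⟨W, hW, hW'⟩ := ih
    -- Via `Nat.pair`, one point codes a sequence of points; `f i` extracts the `i`-th, a code for
    -- the complement of the `i`-th set of the union.
    let f : ℕ → (ℕ → Bool) × (ℕ → Bool) → (ℕ → Bool) × (ℕ → Bool) :=
      fun i p => (fun j => p.1 (Nat.pair i j), p.2)
    have hf : ∀ i, Continuous (f i) := fun i => by
      refine Continuous.prodMk (continuous_pi fun j => ?_) continuous_snd
      exact (continuous_apply _).comp continuous_fst
    refine ⟨⋃ i, f i ⁻¹' Wᶜ, ⟨fun i => f i ⁻¹' Wᶜ, fun i => ?_, rfl⟩, ?_⟩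
    · simpa using boldSigma_preimage (hf i) hW
    · rintro U ⟨t, ht, rfl⟩
      choose c hc using fun i => hW' _ (ht i)
      refine ⟨fun m => c m.unpair.1 m.unpair.2, Set.ext fun x => ?_⟩
      simp only [Set.mem_iUnion, f, Set.mem_preimage, Set.mem_compl_iff, Set.mem_ofPred_eq,
        Nat.unpair_pair]
      refine exists_congr fun i => ?_
      have : x ∈ (t i)ᶜ ↔ (c i, x) ∈ W := by rw [hc i]; rfl
      rw [← not_iff_not, not_not]
      exact this

/-- Cantor's diagonal: if the complement of the diagonal of a universal set had a code `c`, then `c`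
would both belong and not belong to it. -/
theorem exists_boldSigma_compl_notMem (n : ℕ) :
    ∃ U : Set (ℕ → Bool), U ∈ boldSigma (n + 1) ∧ Uᶜ ∉ boldSigma (n + 1) := by
  obtain ⟨W, hW, hW'⟩ := exists_universal n
  refine ⟨(fun x => (x, x)) ⁻¹' W,
    boldSigma_preimage (continuous_id.prodMk continuous_id) hW, fun h => ?_⟩
  obtain ⟨c, hc⟩ := hW' _ h
  have := Set.ext_iff.1 hc c
  simp only [Set.mem_compl_iff, Set.mem_preimage, Set.mem_ofPred_eq] at this
  tauto

/-- A `Π⁰_ω` set is the intersection of a sequence of sets whose `k`-th term is `Σ⁰_{k+1}`. -/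
theorem exists_iInter_boldSigma {S : Set (ℕ → Bool)} (hS : S ∈ boldPiOmega) :
    ∃ t : ℕ → Set (ℕ → Bool), (∀ k, t k ∈ boldSigma (k + 1)) ∧ S = ⋂ k, t k := by
  classical
  obtain ⟨t, ht, rfl⟩ := hS
  choose n hn ht using ht
  -- Each index `i` is proposed for infinitely many `k`; `t i` is used when level `k + 1` can hold
  -- it, and the whole space otherwise.
  refine ⟨fun k => if n k.unpair.1 ≤ k + 1 then t k.unpair.1 else Set.univ, fun k => ?_, ?_⟩
  · dsimp only
    split_ifs with h
    · have := ht k.unpair.1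
      obtain ⟨m, hm⟩ := Nat.exists_eq_add_of_le' (hn k.unpair.1)
      rw [hm] at this h
      exact boldSigma_mono (by omega) this
    · exact boldSigma_of_isClopen isClopen_univ k
  · refine Set.Subset.antisymm (Set.subset_iInter fun k => ?_) (Set.subset_iInter fun i => ?_)
    · split_ifs
      exacts [Set.iInter_subset _ _, Set.subset_univ _]
    -- Here `k = Nat.pair i (n i)` is at least `n i`, so `t i` does occur.
    · refine (Set.iInter_subset _ (Nat.pair i (n i))).trans ?_
      rw [Nat.unpair_pair, if_pos ((Nat.right_le_pair i (n i)).trans (Nat.le_succ _))]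

/-! ### Continuous families of trees -/

/-- A family of trees that depends continuously on a point of Cantor space. -/
def ContinuousFamily (T : (ℕ → Bool) → Set (List ℕ)) : Prop := ∀ s, IsClopen {x | s ∈ T x}

theorem continuousFamily_const (T : Set (List ℕ)) : ContinuousFamily fun _ => T := fun s => by
  by_cases h : s ∈ T <;> simp [h, isClopen_univ, isClopen_empty]

theorem ContinuousFamily.join {T : ℕ → (ℕ → Bool) → Set (List ℕ)}
    (h : ∀ n, ContinuousFamily (T n)) : ContinuousFamily fun x => join fun n => T n x := by
  rintro (_ | ⟨n, s⟩)
  · simp [isClopen_univ]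
  · simpa using h n s

theorem ContinuousFamily.graft {T : ℕ → (ℕ → Bool) → Set (List ℕ)}
    (h : ∀ n, ContinuousFamily (T n)) : ContinuousFamily fun x => graft fun n => T n x := by
  have hfork : ∀ k, ContinuousFamily fun x => fork (T k x) := fun k => by
    refine .join (T := fun n x => if n = 0 then {[]} else if n = 1 then T k x else ∅) fun n => ?_
    split_ifs
    exacts [continuousFamily_const _, h k, continuousFamily_const _]
  refine .join (T := fun k x => stem (T k x) (2 * k)) fun k => ?_
  induction 2 * k with
  | zero => exact hfork k
  | succ m ih =>
    refine .join (T := fun n x => if n = 0 then stem (T k x) m else ∅) fun n => ?_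
    split_ifs
    exacts [ih, continuousFamily_const _]

/-- The recursion of the trees mirrors that of the hierarchy: `E` differs from `A` by one
existential search for a child of the opposite kind. -/
theorem exists_family_isKind (k : ℕ) (U : Set (ℕ → Bool)) (hU : U ∈ boldSigma (k + 1)) :
    ∃ T : (ℕ → Bool) → Set (List ℕ), ContinuousFamily T ∧ (∀ x ∈ U, IsKind true k (T x)) ∧
      ∀ x ∉ U, IsKind false k (T x) := by
  classical
  induction k generalizing U with
  | zero =>
    refine ⟨fun x => join fun n => if x ∈ clopenApprox U n then {[]} else ∅,
      .join (T := fun n x => if x ∈ clopenApprox U n then {[]} else ∅) fun n s => ?_,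
      fun x hx => ⟨by simp, ?_, fun n => ?_⟩, fun x hx => ?_⟩
    · have : {x | s ∈ (if x ∈ clopenApprox U n then {[]} else ∅ : Set (List ℕ))} =
          {x | s = []} ∩ clopenApprox U n := by
        ext x
        by_cases hx : x ∈ clopenApprox U n <;> simp [hx]
      rw [this]
      exact IsClopen.inter (by by_cases hs : s = [] <;> simp [hs, isClopen_univ, isClopen_empty]) (isClopen_clopenApprox U n)
    -- The approximations increase, so once `x` enters at stage `m`, all `[n]` with `n ≥ m` are
    -- leaves.
    · obtain ⟨m, hm⟩ := exists_mem_clopenApprox hU hx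
      refine (Set.infinite_of_injective_forall_mem (f := fun i : ℕ => m + i)
        (fun a b h => by simpa using h) fun i => ?_)
      simp [clopenApprox_mono U (Nat.le_add_right m i) hm]
    · rw [above_join]
      split_ifs <;> simp
    · ext s
      rcases s with - | ⟨n, s⟩
      · simp
      · have : x ∉ clopenApprox U n := fun h => hx (clopenApprox_subset U n h)
        simp [this]
  | succ k ih =>
    obtain ⟨t, ht, rfl⟩ := hU
    choose T hT hT₁ hT₂ using fun i => ih _ (ht i)
    obtain ⟨hE, -⟩ := isKind_backForth k
    have hor : ∀ i x, ∃ b, IsKind b k (T i x) := fun i x => by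
      by_cases hx : x ∈ (t i)ᶜ
      exacts [⟨_, hT₁ i x hx⟩, ⟨_, hT₂ i x hx⟩]
    -- Odd positions hold fixed copies of `E_{k+1}`. At even ones `(n / 2).unpair.1` runs through
    -- every `i` infinitely often, so a single `i` with `x ∈ t i` yields infinitely many copies of
    -- `A_{k+1}`.
    have hE' : ∀ x, {n | IsKind true k (above (join fun n =>
        if Even n then T (n / 2).unpair.1 x else (backForth k).1) n)}.Infinite := fun x => by
      refine Set.infinite_of_injective_forall_mem (f := fun n : ℕ => 2 * n + 1)
        (fun a b h => by simpa using h) fun n => ?_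
      simpa [above_join] using hE
    refine ⟨fun x => join fun n => if Even n then T (n / 2).unpair.1 x else (backForth k).1,
      .join (T := fun n x => if Even n then T (n / 2).unpair.1 x else (backForth k).1)
        fun n => ?_,
      fun x hx => ⟨by simp, hE' x, ?_, fun n => ?_⟩, fun x hx => ⟨by simp, hE' x, fun n => ?_⟩⟩
    · split_ifs
      exacts [hT _, continuousFamily_const _]
    · obtain ⟨i, hi⟩ := Set.mem_iUnion.1 hx
      refine Set.infinite_of_injective_forall_mem (f := fun n : ℕ => 2 * Nat.pair i n)
        (fun a b h => by simpa using h) fun n => ?_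
      simpa [above_join] using hT₂ i x (by simpa using hi)
    · right
      rw [above_join]
      split_ifs
      exacts [hor _ _, ⟨true, hE⟩]
    · right
      rw [above_join]
      split_ifs
      · exact hT₁ _ x fun h => hx (Set.mem_iUnion.2 ⟨_, h⟩)
      · exact hE

/-! ### The disjoint union of the constants and a tree -/

/-- A tree as an `L₀`-structure. -/
abbrev treeStructure (T : Set (List ℕ)) : forestLang.Structure T :=
  mkForest (fun i s => s.1.length = i) (fun i s t => s.1.length = i ∧ ∃ n, t.1 = s.1 ++ [n])

/-- The disjoint union of the constants and the tree `T`. -/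
def ForestModel (T : Set (List ℕ)) : Type := NewConst ⊕ T

/-- Infinite sets of sequences that contain the root. -/
class IsRooted (T : Set (List ℕ)) : Prop where
  nil_mem : [] ∈ T
  infinite : T.Infinite

instance isRooted_graft (Q : ℕ → Set (List ℕ)) : IsRooted (graft Q) where
  nil_mem := nil_mem_join _
  infinite := Set.infinite_of_injective_forall_mem (f := fun k => [k])
    (fun a b h => by simpa using h) fun k => by simp [graft, nil_mem_stem]

instance isRooted_combinedTree : IsRooted combinedTree := by
  rw [combinedTree_eq_graft]
  infer_instance

namespace ForestModel

variable {T : Set (List ℕ)}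

/-- The nodes of the tree as elements of the model. -/
def node (s : T) : ForestModel T := Sum.inr s

/-- The constants as elements of the model. -/
def const (c : NewConst) : ForestModel T := Sum.inl c

@[elab_as_elim]
theorem cases {P : ForestModel T → Prop} (h₁ : ∀ c, P (const c)) (h₂ : ∀ s, P (node s))
    (m : ForestModel T) : P m := Sum.casesOn m h₁ h₂

/-- The root of the tree. -/
def root (T : Set (List ℕ)) [IsRooted T] : ForestModel T := node ⟨[], IsRooted.nil_mem⟩

noncomputable instance : forestLang.Structure (ForestModel T) := @sumForest NewConst T _ (treeStructure T)

instance : (constantsOn NewConst).Structure (ForestModel T) := constantsOn.structure const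

instance [IsRooted T] : (constantsOn (Fin 1)).Structure (ForestModel T) :=
  constantsOn.structure fun _ => root T

instance [IsRooted T] : Nonempty (ForestModel T) := ⟨root T⟩

theorem onLevel_node {i : ℕ} {s : T} : OnLevel i (node s) ↔ s.1.length = i := Iff.rfl

theorem below_node {i : ℕ} {s t : T} :
    Below i (node s) (node t) ↔ s.1.length = i ∧ ∃ n, t.1 = s.1 ++ [n] := Iff.rfl

theorem below_const {i : ℕ} {c d : NewConst} :
    Below i (const c : ForestModel T) (const d) ↔ Below i c d := Iff.rfl

theorem not_below_const_node {i : ℕ} {c : NewConst} {s : T} : ¬ Below i (const c) (node s) := id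

theorem not_below_node_const {i : ℕ} {c : NewConst} {s : T} : ¬ Below i (node s) (const c) := id

/-- The elements of all models `ForestModel T` lie in one countable set. -/
def val : ForestModel T → NewConst ⊕ List ℕ := Sum.map id Subtype.val

@[simp] theorem val_const (c : NewConst) : val (const c : ForestModel T) = Sum.inl c := rfl

@[simp] theorem val_node (s : T) : val (node s) = Sum.inr s.1 := rfl

theorem val_injective : Function.Injective (val : ForestModel T → _) :=
  Function.Injective.sumMap Function.injective_id Subtype.val_injective

/-- The relations see only the sequences and constants themselves; the choice of the tree affects
the domain alone. -/
theorem relMap_congr {S T : Set (List ℕ)} {n : ℕ} (r : forestLang.Relations n)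
    (a : Fin n → ForestModel S) (b : Fin n → ForestModel T) (h : ∀ i, val (a i) = val (b i)) :
    Structure.RelMap r a ↔ Structure.RelMap r b := by
  cases r with
  | level i =>
    have ea : a = ![a 0] := by ext k; fin_cases k; rfl
    have eb : b = ![b 0] := by ext k; fin_cases k; rfl
    rw [ea, eb]
    have h0 := h 0
    generalize a 0 = x at h0
    generalize b 0 = y at h0
    induction x using cases <;> induction y using cases <;>
      simp only [val_const, val_node, Sum.inl.injEq, Sum.inr.injEq, reduceCtorEq] at h0
    · subst h0
      exact Iff.rfl
    · rename_i s t
      exact show OnLevel i (node s) ↔ OnLevel i (node t) by rw [onLevel_node, onLevel_node, h0]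
  | below i =>
    have ea : a = ![a 0, a 1] := by ext k; fin_cases k <;> rfl
    have eb : b = ![b 0, b 1] := by ext k; fin_cases k <;> rfl
    rw [ea, eb]
    have h0 := h 0
    have h1 := h 1
    generalize a 0 = x at h0
    generalize b 0 = y at h0
    generalize a 1 = x' at h1
    generalize b 1 = y' at h1
    induction x using cases <;> induction y using cases <;>
      simp only [val_const, val_node, Sum.inl.injEq, Sum.inr.injEq, reduceCtorEq] at h0 <;>
    induction x' using cases <;> induction y' using cases <;>
      simp only [val_const, val_node, Sum.inl.injEq, Sum.inr.injEq, reduceCtorEq] at h1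
    · subst h0 h1
      exact Iff.rfl
    · exact Iff.rfl
    · exact Iff.rfl
    · rename_i s t s' t'
      exact show Below i (node s) (node s') ↔ Below i (node t) (node t') by
        rw [below_node, below_node, h0, h1]

/-! ### Isomorphic trees give isomorphic models -/

theorem exists_equiv_of_treeIso {S T : Set (List ℕ)} [IsRooted S] [IsRooted T]
    (hS : PrefixClosed S) (h : TreeIso S T) :
    Nonempty (ForestModel S ≃[treeLang[[Fin 1]]] ForestModel T) := by
  obtain ⟨f, hf, hf'⟩ := h
  let e : S ≃ T := hf.equiv f
  have he : ∀ s, (e s).1 = f s.1 := fun s => rfl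
  let g : ForestModel S ≃ ForestModel T := Equiv.sumCongr (Equiv.refl _) e
  have g1 : ∀ c, g (const c) = const c := fun c => rfl
  have g2 : ∀ s, g (node s) = node (e s) := fun c => rfl
  have groot : g (root S) = root T := by
    rw [root, g2, root]
    refine congrArg node (Subtype.ext ?_)
    have := (hf' [] IsRooted.nil_mem).1
    simpa [he] using this
  have hbelow : ∀ (i : ℕ) (s t : S), Below i (node (e s)) (node (e t)) ↔ Below i (node s) (node t) := by
    intro i s t
    -- This expresses the child relation by length and `dropLast`, the data that a `TreeIso`
    -- preserves.
    have key : ∀ u v : List ℕ, (∃ n, v = u ++ [n]) ↔ v.length ≠ 0 ∧ v.dropLast = u := by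
      intro u v
      constructor
      · rintro ⟨n, rfl⟩
        simp
      · rintro ⟨h, rfl⟩
        have h' : v ≠ [] := fun e => h (by simp [e])
        exact ⟨v.getLast h', (List.dropLast_append_getLast h').symm⟩
    rw [below_node, below_node, he, he, key, key, (hf' _ s.2).1, (hf' _ t.2).1, ← (hf' _ t.2).2,
      hf.injOn.eq_iff (hS.dropLast_mem t.2) s.2]
  refine ⟨⟨g, ?_, ?_⟩⟩
  · rintro n ((f | f) | f) x
    · exact f.elim
    · cases n with
      | zero => rfl
      | succ n => exact isEmptyElim f
    · cases n with
      | zero => exact groot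
      | succ n => exact isEmptyElim f
  · rintro n ((r | r) | r) x
    · change Structure.RelMap (L := forestLang) r (g ∘ x) ↔ Structure.RelMap (L := forestLang) r x
      cases r with
      | level i =>
        have ex : x = ![x 0] := by ext k; fin_cases k; rfl
        have egx : g ∘ x = ![g (x 0)] := by ext k; fin_cases k; rfl
        rw [egx, ex]
        generalize x 0 = y
        induction y using cases with
        | h₁ c => exact Iff.rfl
        | h₂ s =>
          change OnLevel i (node (e s)) ↔ OnLevel i (node s)
          rw [onLevel_node, onLevel_node, he, (hf' _ s.2).1]
      | below i =>
        have ex : x = ![x 0, x 1] := by ext k; fin_cases k <;> rfl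
        have egx : g ∘ x = ![g (x 0), g (x 1)] := by ext k; fin_cases k <;> rfl
        rw [egx, ex]
        generalize x 0 = y
        generalize x 1 = z
        induction y using cases <;> induction z using cases
        · exact Iff.rfl
        · exact Iff.rfl
        · exact Iff.rfl
        · exact hbelow i _ _
    · exact isEmptyElim r
    · exact isEmptyElim r

end ForestModel

/-! ### Copies with domain `ω` -/

section Enumeration

open ForestModel

theorem exists_code : ∃ c : NewConst ⊕ List ℕ → ℕ, Function.Injective c :=
  exists_injective_nat _

/-- An injective coding of the elements of the models `ForestModel T`. -/
noncomputable def code : NewConst ⊕ List ℕ → ℕ := exists_code.choose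

theorem code_injective : Function.Injective code := exists_code.choose_spec

/-- The codes of the elements of `ForestModel T`. -/
def codes (T : Set (List ℕ)) : Set ℕ := Set.range fun m : ForestModel T => code (val m)

theorem codes_infinite (T : Set (List ℕ)) [h : IsRooted T] : (codes T).Infinite := by
  have : Infinite T := h.infinite.to_subtype
  have : Infinite (ForestModel T) := inferInstanceAs (Infinite (NewConst ⊕ T))
  exact Set.infinite_range_of_injective (code_injective.comp val_injective)

open Classical in
/-- The enumeration of `ForestModel T` in the order of the codes. -/
noncomputable def enum (T : Set (List ℕ)) [IsRooted T] : ForestModel T ≃ ℕ :=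
  Equiv.ofBijective (fun m => Nat.count (· ∈ codes T) (code (val m))) <| by
    constructor
    · intro a b hab
      exact val_injective (code_injective (Nat.count_injective ⟨a, rfl⟩ ⟨b, rfl⟩ hab))
    · intro n
      obtain ⟨m, hm⟩ := Nat.nth_mem_of_infinite (p := (· ∈ codes T)) (codes_infinite T) n
      refine ⟨m, ?_⟩
      change Nat.count (· ∈ codes T) (code (val m)) = n
      rw [show code (val m) = _ from hm, Nat.count_nth_of_infinite (p := (· ∈ codes T))
        (codes_infinite T)]

open Classical in
theorem enum_apply (T : Set (List ℕ)) [IsRooted T] (m : ForestModel T) :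
    enum T m = Nat.count (· ∈ codes T) (code (val m)) := rfl

/-- The copy of `ForestModel T` with domain `ω`. -/
noncomputable abbrev natModel (T : Set (List ℕ)) [IsRooted T] : (treeLang[[Fin 1]]).Structure ℕ :=
  Equiv.inducedStructure (enum T)

theorem realize_natModel (T : Set (List ℕ)) [IsRooted T] (φ : (treeLang[[Fin 1]]).Sentence) :
    @Sentence.Realize _ ℕ (natModel T) φ ↔ ForestModel T ⊨ φ := by
  let := natModel T
  exact (StrongHomClass.realize_sentence (Equiv.inducedStructureEquiv (enum T)) φ).symm

theorem eventually_codes {T : (ℕ → Bool) → Set (List ℕ)} (hT : ContinuousFamily T) (x : ℕ → Bool) (j : ℕ) :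
    ∀ᶠ y in nhds x, j ∈ codes (T y) ↔ j ∈ codes (T x) := by
  by_cases hj : j ∈ Set.range code
  · obtain ⟨p, rfl⟩ := hj
    have key : ∀ y, code p ∈ codes (T y) ↔ ∃ m : ForestModel (T y), val m = p := fun y =>
      exists_congr fun m => code_injective.eq_iff
    simp only [key]
    rcases p with c | s
    · exact .of_forall fun y => iff_of_true ⟨const c, rfl⟩ ⟨const c, rfl⟩
    · have key' : ∀ y, (∃ m : ForestModel (T y), val m = Sum.inr s) ↔ s ∈ T y := by
        intro y
        constructor
        · rintro ⟨m, hm⟩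
          induction m using ForestModel.cases with
          | h₁ c => simp at hm
          | h₂ t =>
            simp only [val_node, Sum.inr.injEq] at hm
            exact hm ▸ t.2
        · exact fun hs => ⟨node ⟨s, hs⟩, rfl⟩
      simp only [key']
      exact eventually_of_isClopen (hT s) x
  · have : ∀ y, j ∉ codes (T y) := fun y ⟨m, hm⟩ => hj ⟨_, hm⟩
    simp [this]

variable {T : (ℕ → Bool) → Set (List ℕ)} [∀ x, IsRooted (T x)]

/-- The number of an element is the count of smaller codes in use, hence is decided by finitely many
locally constant conditions. Elements of different models are compared through `val`. -/
theorem eventually_enum (hT : ContinuousFamily T) (x : ℕ → Bool) (m : ForestModel (T x)) :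
    ∀ᶠ y in nhds x, ∀ m' : ForestModel (T y), val m' = val m →
      enum (T y) m' = enum (T x) m := by
  classical
  filter_upwards [(Filter.eventually_all_finite (Set.finite_lt_nat (code (val m)))).2
    fun j _ => eventually_codes hT x j] with y hy m' hm
  rw [enum_apply, enum_apply, hm, Nat.count_eq_card_filter_range, Nat.count_eq_card_filter_range]
  exact congrArg _ (Finset.filter_congr fun j hj => hy j (Finset.mem_range.1 hj))

theorem eventually_enum_symm (hT : ContinuousFamily T) (x : ℕ → Bool) (n : ℕ) :
    ∀ᶠ y in nhds x, val ((enum (T y)).symm n) = val ((enum (T x)).symm n) := by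
  filter_upwards [eventually_enum hT x ((enum (T x)).symm n),
    eventually_codes hT x (code (val ((enum (T x)).symm n)))] with y hy hy'
  obtain ⟨m, hm⟩ := hy'.2 ⟨_, rfl⟩
  have hm' := code_injective hm
  have := hy m hm'
  rw [Equiv.apply_symm_apply] at this
  have hn : (enum (T y)).symm n = m := by rw [← this, Equiv.symm_apply_apply]
  rw [hn, hm']

/-- A family of structures with domain `ω` that depends continuously on a point. -/
structure ContinuousStructures {X : Type*} [TopologicalSpace X] {L : FirstOrder.Language}
    (S : X → L.Structure ℕ) : Prop where
  fun_eq : ∀ (n : ℕ) (f : L.Functions n) (a : Fin n → ℕ) (x : X),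
    ∀ᶠ y in nhds x, (S y).funMap f a = (S x).funMap f a
  rel_iff : ∀ (n : ℕ) (r : L.Relations n) (a : Fin n → ℕ) (x : X),
    ∀ᶠ y in nhds x, (S y).RelMap r a ↔ (S x).RelMap r a

theorem continuousStructures_natModel (hT : ContinuousFamily T) :
    ContinuousStructures fun x => natModel (T x) where
  fun_eq := by
    rintro n ((f | f) | f) a x
    · exact f.elim
    · cases n with
      | zero =>
        filter_upwards [eventually_enum hT x (const f)] with y hy
        exact hy (const f) rfl
      | succ n => exact isEmptyElim f
    · cases n with
      | zero =>
        filter_upwards [eventually_enum hT x (root (T x))] with y hy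
        exact hy (root (T y)) rfl
      | succ n => exact isEmptyElim f
  rel_iff := by
    rintro n ((r | r) | r) a x
    · filter_upwards [Filter.eventually_all.2 fun i => eventually_enum_symm hT x (a i)] with y hy
      exact relMap_congr r _ _ hy
    · exact isEmptyElim r
    · exact isEmptyElim r

end Enumeration

/-! ### Formulas in continuous families of structures -/

namespace ContinuousStructures

variable {X : Type*} [TopologicalSpace X] {L : FirstOrder.Language} {S : X → L.Structure ℕ}

theorem withConstants (h : ContinuousStructures S) :
    ContinuousStructures fun x => @withConstantsSelfStructure L ℕ (S x) where
  fun_eq := by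
    rintro n (f | c) a x
    · exact h.fun_eq n f a x
    · cases n with
      | zero => exact .of_forall fun y => rfl
      | succ n => exact isEmptyElim c
  rel_iff := by
    rintro n (r | r) a x
    · exact h.rel_iff n r a x
    · exact isEmptyElim r

theorem eventually_realize_term (h : ContinuousStructures S) {β : Type*} (t : L.Term β)
    (v : β → ℕ) (x : X) :
    ∀ᶠ y in nhds x, @Term.realize L ℕ (S y) β v t = @Term.realize L ℕ (S x) β v t := by
  induction t with
  | var i => exact .of_forall fun y => rfl
  | func f ts ih =>
    filter_upwards [Filter.eventually_all.2 ih,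
      h.fun_eq _ f (fun i => @Term.realize L ℕ (S x) β v (ts i)) x] with y h1 h2
    simp only [Term.realize]
    rw [funext h1]
    exact h2

theorem eventually_realize_of_isQF (h : ContinuousStructures S) {β : Type*} {n : ℕ}
    {φ : L.BoundedFormula β n} (hφ : φ.IsQF) (v : β → ℕ) (xs : Fin n → ℕ) (x : X) :
    ∀ᶠ y in nhds x, @BoundedFormula.Realize L ℕ (S y) β n φ v xs ↔
      @BoundedFormula.Realize L ℕ (S x) β n φ v xs := by
  induction hφ with
  | falsum => exact .of_forall fun y => Iff.rfl
  | of_isAtomic hφ =>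
    cases hφ with
    | equal t₁ t₂ =>
      filter_upwards [h.eventually_realize_term t₁ (Sum.elim v xs) x,
        h.eventually_realize_term t₂ (Sum.elim v xs) x] with y h1 h2
      simp only [Term.bdEqual, BoundedFormula.Realize, h1, h2]
    | rel R ts =>
      filter_upwards [Filter.eventually_all.2 fun i =>
        h.eventually_realize_term (ts i) (Sum.elim v xs) x,
        h.rel_iff _ R (fun i => @Term.realize L ℕ (S x) _ (Sum.elim v xs) (ts i)) x] with y h1 h2
      simp only [Relations.boundedFormula, BoundedFormula.Realize]
      rw [funext h1]
      exact h2
  | imp _ _ ih₁ ih₂ =>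
    filter_upwards [ih₁, ih₂] with y h1 h2
    simp only [BoundedFormula.Realize, h1, h2]

/-- A quantifier over `ω` is a countable union or intersection. A whole block costs one level only,
since `Σ⁰ₙ` is closed under countable unions. -/
theorem boldSigma_of_prenexClass (h : ContinuousStructures S) {β : Type*} (v : β → ℕ) (k : ℕ) :
    (∀ (n : ℕ) (φ : L.BoundedFormula β n) (xs : Fin n → ℕ), prenexClass false k n φ →
      {x | @BoundedFormula.Realize L ℕ (S x) β n φ v xs} ∈ boldSigma (k + 1)) ∧
    ∀ (n : ℕ) (φ : L.BoundedFormula β n) (xs : Fin n → ℕ), prenexClass true k n φ →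
      {x | @BoundedFormula.Realize L ℕ (S x) β n φ v xs}ᶜ ∈ boldSigma (k + 1) := by
  induction k with
  | zero =>
    have key : ∀ (n : ℕ) (φ : L.BoundedFormula β n) (xs : Fin n → ℕ), φ.IsQF →
        IsClopen {x | @BoundedFormula.Realize L ℕ (S x) β n φ v xs} := fun n φ xs hφ =>
      isClopen_of_eventually fun x => h.eventually_realize_of_isQF hφ v xs x
    exact ⟨fun n φ xs hφ => boldSigma_of_isClopen (key n φ xs hφ) 0,
      fun n φ xs hφ => boldSigma_of_isClopen (key n φ xs hφ).compl 0⟩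
  | succ k ih =>
    refine ⟨fun n φ xs hφ => ?_, fun n φ xs hφ => ?_⟩
    · change ExBlock (prenexClass true k) n φ at hφ
      induction hφ with
      | base hφ => exact boldSigma_of_compl (ih.2 _ _ _ hφ)
      | @ex n φ _ ih' =>
        have : {x | @BoundedFormula.Realize L ℕ (S x) β n φ.ex v xs} =
            ⋃ a : ℕ, {x | @BoundedFormula.Realize L ℕ (S x) β _ φ v (Fin.snoc xs a)} := by
          ext x
          simp
        rw [this]
        exact boldSigma_iUnion fun a => ih' _
    · change AllBlock (prenexClass false k) n φ at hφ
      induction hφ with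
      | base hφ => exact boldSigma_of_compl (by simpa using ih.1 _ _ _ hφ)
      | @all n φ _ ih' =>
        have : {x | @BoundedFormula.Realize L ℕ (S x) β n φ.all v xs}ᶜ =
            ⋃ a : ℕ, {x | @BoundedFormula.Realize L ℕ (S x) β _ φ v (Fin.snoc xs a)}ᶜ := by
          ext x
          simp
        rw [this]
        exact boldSigma_iUnion fun a => ih' _

theorem continuous_atomicDiagram (h : ContinuousStructures S) (e : ℕ → AtomicSentence L) :
    Continuous fun x => atomicDiagram e (S x) := by
  refine continuous_pi fun i => (IsLocallyConstant.iff_eventually_eq _).2 (fun x => ?_) |>.continuous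
  exact (h.withConstants.eventually_realize_of_isQF (.of_isAtomic (e i).2) _ _ x).mono
    fun y hy => decide_eq_decide.2 hy

end ContinuousStructures

/-- A structure with domain `ω` is determined by its atomic diagram. -/
theorem atomicDiagram_injective {L : FirstOrder.Language} {e : ℕ → AtomicSentence L}
    (he : Function.Surjective e) : Function.Injective (atomicDiagram e) := by
  intro S S' hSS
  have key : ∀ φ : AtomicSentence L,
      @Sentence.Realize L[[ℕ]] ℕ (@withConstantsSelfStructure L ℕ S) φ.1 ↔
      @Sentence.Realize L[[ℕ]] ℕ (@withConstantsSelfStructure L ℕ S') φ.1 := by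
    intro φ
    obtain ⟨i, rfl⟩ := he φ
    exact decide_eq_decide.1 (congrFun hSS i)
  -- The constant for `c` denotes `c` in every structure, so the sentences `f(a) = b` and `R(a)`
  -- record all of the interpretation.
  have hc : ∀ (R : L.Structure ℕ) (v : Empty ⊕ Fin 0 → ℕ) (c : ℕ), @Term.realize L[[ℕ]] ℕ
      (@withConstantsSelfStructure L ℕ R) (Empty ⊕ Fin 0) v (Constants.term (L.con c)) = c :=
    fun R v c => rfl
  ext n f a
  · have := key ⟨Term.bdEqual (Term.func (Sum.inl f : L[[ℕ]].Functions n)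
      fun i => Constants.term (L.con (a i))) (Constants.term (L.con (S.funMap f a))),
      .equal _ _⟩
    have key' : ∀ R : L.Structure ℕ, @Sentence.Realize L[[ℕ]] ℕ
        (@withConstantsSelfStructure L ℕ R) (Term.bdEqual (Term.func
          (Sum.inl f : L[[ℕ]].Functions n) fun i => Constants.term (L.con (a i)))
          (Constants.term (L.con (S.funMap f a)))) ↔ R.funMap f a = S.funMap f a := by
      intro R
      have h : ∀ (b : Fin n → ℕ) (c : ℕ), b = a → c = S.funMap f a →
          (R.funMap f b = c ↔ R.funMap f a = S.funMap f a) := by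
        rintro _ _ rfl rfl
        rfl
      exact h _ _ (funext fun i => hc R _ (a i)) (hc R _ _)
    exact ((key' S').1 (this.1 ((key' S).2 rfl))).symm
  · have := key ⟨Relations.boundedFormula (Sum.inl f : L[[ℕ]].Relations n)
      fun i => Constants.term (L.con (a i)), .rel _ _⟩
    have key' : ∀ R : L.Structure ℕ, @Sentence.Realize L[[ℕ]] ℕ
        (@withConstantsSelfStructure L ℕ R) (Relations.boundedFormula
          (Sum.inl f : L[[ℕ]].Relations n) fun i => Constants.term (L.con (a i))) ↔
        R.RelMap f a := by
      intro R
      have h : ∀ b : Fin n → ℕ, b = a → (R.RelMap f b ↔ R.RelMap f a) := by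
        rintro _ rfl
        rfl
      exact h _ (funext fun i => hc R _ (a i))
    exact (key' S).symm.trans (this.trans (key' S'))

/-! ### Formulas about the trees

The free variables of the formulas are numbered; the variable `0` is for the root. -/

/-- The formula `∃ xᵢ φ`. -/
noncomputable def exVar (i : ℕ) (φ : forestLang.Formula ℕ) : forestLang.Formula ℕ :=
  (φ.relabel fun j => if j = i then Sum.inr () else Sum.inl j : forestLang.Formula (ℕ ⊕ Unit)).iExs
    Unit

theorem realize_exVar {M : Type} [forestLang.Structure M] {i : ℕ} {φ : forestLang.Formula ℕ}
    {v : ℕ → M} : (exVar i φ).Realize v ↔ ∃ a, φ.Realize (Function.update v i a) := by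
  rw [exVar, Formula.realize_iExs]
  simp only [Formula.realize_relabel]
  have key : ∀ u : Unit → M, (Sum.elim v u ∘ fun j => if j = i then Sum.inr () else Sum.inl j) =
      Function.update v i (u ()) := by
    intro u
    funext j
    by_cases h : j = i
    · subst h
      simp
    · simp [h]
  simp only [key]
  exact ⟨fun ⟨u, hu⟩ => ⟨u (), hu⟩, fun ⟨a, ha⟩ => ⟨fun _ => a, ha⟩⟩

/-- The formula `xᵢ <ₗ xⱼ`. -/
def lessVar (l i j : ℕ) : forestLang.Formula ℕ :=
  Relations.formula₂ (L := forestLang) (ForestRel.below l) (Term.var i) (Term.var j)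

/-- The formula `xᵢ = xⱼ`. -/
def eqVar (i j : ℕ) : forestLang.Formula ℕ := Term.equal (Term.var i) (Term.var j)

theorem realize_lessVar {M : Type} [forestLang.Structure M] {l i j : ℕ} {v : ℕ → M} :
    (lessVar l i j).Realize v ↔ Below l (v i) (v j) := by
  simp [lessVar]

theorem realize_eqVar {M : Type} [forestLang.Structure M] {i j : ℕ} {v : ℕ → M} :
    (eqVar i j).Realize v ↔ v i = v j := by
  simp [eqVar]

/-- `xᵢ` is on level `l` of the tree with root `x₀`. -/
noncomputable def reach : ℕ → ℕ → forestLang.Formula ℕ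
  | 0, i => eqVar 0 i
  | l + 1, i => exVar (i + 1) (reach l (i + 1) ⊓ lessVar l (i + 1) i)

/-- `xᵢ` has exactly two children, given that it is on level `l`. -/
noncomputable def twoChildren (l i : ℕ) : forestLang.Formula ℕ :=
  exVar (i + 1) (exVar (i + 2) (((eqVar (i + 1) (i + 2)).not ⊓
    (lessVar l i (i + 1) ⊓ lessVar l i (i + 2))) ⊓
    (exVar (i + 3) (lessVar l i (i + 3) ⊓
      ((eqVar (i + 3) (i + 1)).not ⊓ (eqVar (i + 3) (i + 2)).not))).not))

/-- `x₁` is `F_{k+1}` or `G_{k+1}`. -/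
noncomputable def forkNode (k : ℕ) : forestLang.Formula ℕ :=
  exVar 2 ((reach (2 * k + 1) 2 ⊓ lessVar (2 * k + 1) 2 1) ⊓ twoChildren (2 * k + 1) 2)

/-- `xᵢ` has the property `Tall k`, given that it is on level `l`. -/
noncomputable def tall : ℕ → ℕ → ℕ → forestLang.Formula ℕ
  | 0, l, i => exVar (i + 1) (lessVar l i (i + 1))
  | k + 1, l, i => exVar (i + 1) (lessVar l i (i + 1) ⊓ (tall k (l + 1) (i + 1)).not)

namespace ForestModel

variable {T : Set (List ℕ)}

theorem below_node_iff {l : ℕ} {s : T} (hs : s.1.length = l) {m : ForestModel T} :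
    Below l (node s) m ↔ ∃ (n : ℕ) (h : s.1 ++ [n] ∈ T), m = node ⟨s.1 ++ [n], h⟩ := by
  induction m using cases with
  | h₁ c =>
    refine iff_of_false not_below_node_const ?_
    rintro ⟨n, h, e⟩
    cases e
  | h₂ t =>
    rw [below_node]
    constructor
    · rintro ⟨-, n, hn⟩
      exact ⟨n, hn ▸ t.2, congrArg node (Subtype.ext hn)⟩
    · rintro ⟨n, h, e⟩
      refine ⟨hs, n, ?_⟩
      cases e
      rfl

theorem node_injective : Function.Injective (node : T → ForestModel T) := Sum.inr_injective

theorem realize_reach [IsRooted T] (hT : PrefixClosed T) {l i : ℕ} (hi : i ≠ 0)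
    {v : ℕ → ForestModel T} (hv : v 0 = root T) :
    (reach l i).Realize v ↔ ∃ s : T, v i = node s ∧ s.1.length = l := by
  induction l generalizing i v with
  | zero =>
    rw [reach, realize_eqVar, hv]
    constructor
    · exact fun h => ⟨_, h.symm, rfl⟩
    · rintro ⟨⟨s, hs⟩, h, h'⟩
      obtain rfl := List.length_eq_zero_iff.1 h'
      exact h.symm
  | succ l ih =>
    rw [reach, realize_exVar]
    -- The bound variable has number `i + 1`, so it overwrites neither the root variable `0` nor
    -- `xᵢ`.
    have h0 : ∀ a, Function.update v (i + 1) a 0 = root T := fun a => by simp [hv]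
    have hi' : ∀ a, Function.update v (i + 1) a i = v i := fun a => by simp
    simp only [Formula.realize_inf, realize_lessVar, ih (Nat.succ_ne_zero i) (h0 _), hi',
      Function.update_self]
    constructor
    · rintro ⟨a, ⟨s, rfl, hs⟩, h⟩
      obtain ⟨n, hn, e⟩ := (below_node_iff hs).1 h
      exact ⟨_, e, by simp [hs]⟩
    · rintro ⟨s, e, hs⟩
      refine ⟨node ⟨s.1.dropLast, hT.dropLast_mem s.2⟩, ⟨_, rfl, by simp [hs]⟩, ?_⟩
      have hne : s.1 ≠ [] := fun h => by simp [h] at hs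
      rw [e, below_node]
      exact ⟨by simp [hs], s.1.getLast hne, (List.dropLast_append_getLast hne).symm⟩

theorem realize_twoChildren {l i : ℕ} {v : ℕ → ForestModel T} {s : T} (hv : v i = node s)
    (hs : s.1.length = l) : (twoChildren l i).Realize v ↔ ExactlyTwo T s := by
  simp only [twoChildren, realize_exVar, Formula.realize_inf, Formula.realize_not, realize_eqVar,
    realize_lessVar]
  have e : ∀ a b c : ForestModel T,
      (Function.update (Function.update (Function.update v (i + 1) a) (i + 2) b) (i + 3) c) i =
        node s ∧
      (Function.update (Function.update (Function.update v (i + 1) a) (i + 2) b) (i + 3) c)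
        (i + 1) = a ∧
      (Function.update (Function.update (Function.update v (i + 1) a) (i + 2) b) (i + 3) c)
        (i + 2) = b ∧
      (Function.update (Function.update v (i + 1) a) (i + 2) b) i = node s ∧
      (Function.update (Function.update v (i + 1) a) (i + 2) b) (i + 1) = a := fun a b c => by
    simp [hv, Function.update_of_ne]
  simp only [fun a b c => (e a b c).1, fun a b c => (e a b c).2.1, fun a b c => (e a b c).2.2.1,
    fun a b => (e a b a).2.2.2.1, fun a b => (e a b a).2.2.2.2, Function.update_self,
    below_node_iff hs]
  constructor
  · rintro ⟨_, _, ⟨hab, ⟨m, hm, rfl⟩, ⟨n, hn, rfl⟩⟩, h⟩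
    refine ⟨m, n, ?_, hm, hn, fun c hc => ?_⟩
    · rintro rfl
      exact hab rfl
    · by_contra hne
      rw [not_or] at hne
      refine h ⟨_, ⟨c, hc, rfl⟩, fun e => hne.1 ?_, fun e => hne.2 ?_⟩
      · simpa using congrArg Subtype.val (node_injective e)
      · simpa using congrArg Subtype.val (node_injective e)
  · rintro ⟨m, n, hmn, hm, hn, h⟩
    refine ⟨_, _, ⟨fun e => hmn ?_, ⟨m, hm, rfl⟩, ⟨n, hn, rfl⟩⟩, ?_⟩
    · simpa using congrArg Subtype.val (node_injective e)
    · rintro ⟨_, ⟨c, hc, rfl⟩, h1, h2⟩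
      obtain rfl | rfl := h c hc
      exacts [h1 rfl, h2 rfl]

theorem realize_tall {k l i : ℕ} {v : ℕ → ForestModel T} {s : T} (hv : v i = node s)
    (hs : s.1.length = l) : (tall k l i).Realize v ↔ Tall k {t | s.1 ++ t ∈ T} := by
  have hi' : ∀ a, Function.update v (i + 1) a i = node s := fun a => by simp [hv]
  induction k generalizing l i v s with
  | zero =>
    simp only [tall, realize_exVar, realize_lessVar, hi', Function.update_self, below_node_iff hs]
    constructor
    · rintro ⟨_, n, hn, rfl⟩
      exact ⟨n, hn⟩
    · rintro ⟨n, hn⟩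
      exact ⟨_, n, hn, rfl⟩
  | succ k ih =>
    simp only [tall, realize_exVar, realize_lessVar, Formula.realize_inf, Formula.realize_not,
      hi', Function.update_self, below_node_iff hs]
    have key : ∀ (n : ℕ) (hn : s.1 ++ [n] ∈ T),
        (tall k (l + 1) (i + 1)).Realize (Function.update v (i + 1) (node ⟨s.1 ++ [n], hn⟩)) ↔
          Tall k (above {t | s.1 ++ t ∈ T} n) := by
      intro n hn
      have e : above {t | s.1 ++ t ∈ T} n = {t | (s.1 ++ [n]) ++ t ∈ T} := by
        ext t
        simp
      rw [e]
      exact ih (s := ⟨s.1 ++ [n], hn⟩) (by simp) (by simp [hs]) (fun a => by simp)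
    constructor
    · rintro ⟨_, ⟨n, hn, rfl⟩, h⟩
      exact ⟨n, hn, fun h' => h ((key n hn).2 h')⟩
    · rintro ⟨n, hn, h⟩
      exact ⟨_, ⟨n, hn, rfl⟩, fun h' => h ((key n hn).1 h')⟩

/-! ### The trees above the nodes `G_{k+1}` -/

variable {Q : ℕ → Set (List ℕ)}

theorem nodeG_mem_graft (hQ : ∀ j, ∃ b, IsKind b j (Q j)) (k : ℕ) : nodeG k ∈ graft Q := by
  obtain ⟨b, hb⟩ := hQ k
  rw [← List.append_nil (nodeG k), nodeG_append_mem]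
  exact hb.nil_mem

/-- Among the forks, level `2k + 1` selects `baseNode k`. Its two children are not told apart yet.
-/
theorem realize_forkNode (hQ : ∀ j, ∃ b, IsKind b j (Q j)) {k : ℕ}
    {v : ℕ → ForestModel (graft Q)} (hv : v 0 = root (graft Q)) :
    (forkNode k).Realize v ↔ ∃ s : graft Q, v 1 = node s ∧ (s.1 = leafF k ∨ s.1 = nodeG k) := by
  have hpc : PrefixClosed (graft Q) := prefixClosed_graft fun j => (hQ j).choose_spec.prefixClosed
  have h0 : ∀ a, Function.update v 2 a 0 = root (graft Q) := fun a => by simp [hv]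
  have h1 : ∀ a, Function.update v 2 a 1 = v 1 := fun a => by simp
  simp only [forkNode, realize_exVar, Formula.realize_inf, realize_lessVar,
    realize_reach hpc two_ne_zero (h0 _), Function.update_self, h1]
  obtain ⟨b, hb⟩ := hQ k
  constructor
  · rintro ⟨_, ⟨⟨s, rfl, hs⟩, h⟩, h'⟩
    rw [realize_twoChildren (Function.update_self ..) hs] at h'
    obtain ⟨j, hj⟩ := exists_eq_baseNode (fun j => (hQ j).choose_spec.noTwoChildren) h'
    have : j = k := by
      rw [hj, length_baseNode] at hs
      omega
    subst this
    obtain ⟨n, hn, e⟩ := (below_node_iff hs).1 h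
    refine ⟨_, e, ?_⟩
    rw [hj, baseNode_append_mem, mem_fork] at hn
    simp only [List.cons_ne_nil, List.cons.injEq, and_true, false_or] at hn
    obtain rfl | ⟨t, -, rfl, -⟩ := hn
    · left
      simp only [hj, leafF_eq]
    · right
      simp only [hj, nodeG_eq]
  · rintro ⟨s, e, hs⟩
    have hmem : baseNode k ∈ graft Q := by
      rw [← List.append_nil (baseNode k), baseNode_append_mem]
      exact nil_mem_fork _
    refine ⟨node ⟨baseNode k, hmem⟩, ⟨⟨_, rfl, length_baseNode k⟩, ?_⟩, ?_⟩
    · rw [e, below_node]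
      refine ⟨length_baseNode k, ?_⟩
      obtain hs | hs := hs
      · exact ⟨0, by rw [hs, leafF_eq]⟩
      · exact ⟨1, by rw [hs, nodeG_eq]⟩
    · rw [realize_twoChildren (Function.update_self ..) (length_baseNode k)]
      exact exactlyTwo_baseNode hb.nil_mem

/-- A leaf is never tall, so adding `tall` excludes `F_{k+1}` and tests the tree grafted on
`G_{k+1}`. -/
theorem realize_forkNode_inf_tall (hQ : ∀ j, ∃ b, IsKind b j (Q j)) {k j : ℕ}
    {v : ℕ → ForestModel (graft Q)} (hv : v 0 = root (graft Q)) :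
    (forkNode k ⊓ tall j (2 * k + 2) 1).Realize v ↔
      v 1 = node ⟨nodeG k, nodeG_mem_graft hQ k⟩ ∧ Tall j (Q k) := by
  have hG : (nodeG k).length = 2 * k + 2 := by simp [nodeG]
  have hF : (leafF k).length = 2 * k + 2 := by simp [leafF]
  have htallG : {t | nodeG k ++ t ∈ graft Q} = Q k := by
    ext t
    exact nodeG_append_mem
  have htallF : {t | leafF k ++ t ∈ graft Q} = {[]} := by
    ext t
    exact leafF_append_mem
  have hnot : ¬ Tall j {[]} := by cases j <;> simp [Tall]
  rw [Formula.realize_inf, realize_forkNode hQ hv]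
  constructor
  · rintro ⟨⟨⟨s, hs⟩, e, rfl | rfl⟩, h⟩
    · rw [realize_tall e hF, htallF] at h
      exact absurd h hnot
    · rw [realize_tall e hG, htallG] at h
      exact ⟨e, h⟩
  · rintro ⟨e, h⟩
    refine ⟨⟨_, e, Or.inr rfl⟩, ?_⟩
    rwa [realize_tall e hG, htallG]

theorem realize_exVar_tall (hQ : ∀ j, ∃ b, IsKind b j (Q j)) {k : ℕ}
    {v : ℕ → ForestModel (graft Q)} (hv : v 0 = root (graft Q)) :
    (exVar 1 (forkNode k ⊓ tall k (2 * k + 2) 1)).Realize v ↔ IsKind true k (Q k) := by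
  have h0 : ∀ a, Function.update v 1 a 0 = root (graft Q) := fun a => by simp [hv]
  rw [realize_exVar]
  simp only [realize_forkNode_inf_tall hQ (h0 _), Function.update_self, exists_eq_left]
  obtain ⟨b, hb⟩ := hQ k
  rw [hb.tall_iff]
  refine ⟨fun h => h ▸ hb, fun h => ?_⟩
  rw [← hb.tall_iff, h.tall_iff]

end ForestModel

/-! ### The model of the theory -/

theorem rep_isModel (i : FinModelType) : Rep i ⊨ forestTheory := i.out.isModel

theorem constForest_below {k : ℕ} {i i' : FinModelType} {j j' : ℕ} {m : Rep i} {m' : Rep i'} :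
    Below k (⟨i, j, m⟩ : NewConst) ⟨i', j', m'⟩ ↔
      ∃ h : i = i', j = j' ∧ Below k (h ▸ m) m' := by
  change (∃ (l : FinModelType) (r : ℕ) (n n' : Rep l), (⟨i, j, m⟩ : NewConst) = ⟨l, r, n⟩ ∧
    (⟨i', j', m'⟩ : NewConst) = ⟨l, r, n'⟩ ∧ Below k n n') ↔ _
  constructor
  · rintro ⟨l, r, n, n', h, h', hb⟩
    cases h
    cases h'
    exact ⟨rfl, rfl, hb⟩
  · rintro ⟨rfl, rfl, hb⟩
    exact ⟨i, j, m, m', rfl, rfl, hb⟩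

theorem constForest_isModel : NewConst ⊨ forestTheory := by
  rw [forestTheory_iff]
  have h := fun i => forestTheory_iff.1 (rep_isModel i)
  refine ⟨?_, ?_, ?_, ?_⟩
  · rintro i j hij ⟨l, r, m⟩
    exact (h l).1 i j hij m
  · rintro i ⟨l, r, m⟩ ⟨l', r', m'⟩ hb
    obtain ⟨rfl, rfl, hm⟩ := constForest_below.1 hb
    exact (h l).2.1 i m m' hm
  · rintro i ⟨l, r, m⟩ hm
    obtain ⟨n, hn, hb⟩ := (h l).2.2.1 i m hm
    exact ⟨⟨l, r, n⟩, hn, constForest_below.2 ⟨rfl, rfl, hb⟩⟩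
  · rintro i ⟨l, r, m⟩ ⟨l', r', m'⟩ ⟨l'', r'', m''⟩ hb hb'
    obtain ⟨rfl, rfl, hm⟩ := constForest_below.1 hb
    obtain ⟨rfl, rfl, hm'⟩ := constForest_below.1 hb'
    rw [(h _).2.2.2 i m m' m'' hm hm']

open ForestModel in
theorem forestModel_isModel {T : Set (List ℕ)} (hT : PrefixClosed T) :
    ForestModel T ⊨ forestTheory := by
  obtain ⟨h1, h2, h3, h4⟩ := forestTheory_iff.1 constForest_isModel
  rw [forestTheory_iff]
  refine ⟨fun i j hij a => ?_, fun i a b => ?_, fun i a => ?_, fun i a b c => ?_⟩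
  · induction a using ForestModel.cases with
    | h₁ c => exact h1 i j hij c
    | h₂ s =>
      rintro ⟨ha, hb⟩
      exact hij ((onLevel_node.1 ha).symm.trans (onLevel_node.1 hb))
  · induction a using ForestModel.cases <;> induction b using ForestModel.cases
    · exact h2 i _ _
    · exact fun h => (not_below_const_node h).elim
    · exact fun h => (not_below_node_const h).elim
    · intro h
      obtain ⟨hs, n, hn⟩ := below_node.1 h
      exact ⟨onLevel_node.2 hs, onLevel_node.2 (by simp [hn, hs])⟩
  · induction a using ForestModel.cases with
    | h₁ c =>
      intro h
      obtain ⟨d, hd, hdc⟩ := h3 i c h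
      exact ⟨const d, hd, hdc⟩
    | h₂ s =>
      intro h
      have hs := onLevel_node.1 h
      have hne : s.1 ≠ [] := fun h => by simp [h] at hs
      have hl : s.1.dropLast.length = i := by simp [hs]
      exact ⟨node ⟨s.1.dropLast, hT.dropLast_mem s.2⟩, onLevel_node.2 hl,
        below_node.2 ⟨hl, s.1.getLast hne, (List.dropLast_append_getLast hne).symm⟩⟩
  · induction a using ForestModel.cases <;> induction b using ForestModel.cases <;>
      induction c using ForestModel.cases
    · exact fun h h' => congrArg const (h4 i _ _ _ h h')
    · exact fun h => (not_below_const_node h).elim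
    · exact fun _ h => (not_below_node_const h).elim
    · exact fun h => (not_below_const_node h).elim
    · exact fun h => (not_below_node_const h).elim
    · exact fun _ h => (not_below_const_node h).elim
    · exact fun h => (not_below_node_const h).elim
    · intro h h'
      obtain ⟨-, n, hn⟩ := below_node.1 h
      obtain ⟨-, n', hn'⟩ := below_node.1 h'
      exact congrArg node (Subtype.ext (List.append_inj_left' (hn.symm.trans hn') rfl))

open ForestModel in
-- No relation joins a constant to a node, or two constants of different copies, so each copy is
-- closed under the relations; the tree has only to be a forest.
theorem forestModel_isModel_treeTheory {T : Set (List ℕ)} (hT : PrefixClosed T) :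
    ForestModel T ⊨ treeTheory := by
  have hterm : ∀ (c : NewConst) (n : ℕ) (v : Empty ⊕ Fin n → ForestModel T),
      (constTerm c).realize v = const c := fun c n v => rfl
  have hlevel : ∀ k c, ForestModel T ⊨ levelSentence k c ↔ OnLevel k c := by
    intro k c
    simp only [levelSentence, Sentence.Realize, Formula.Realize, BoundedFormula.realize_rel₁, hterm]
    exact Iff.rfl
  have hbelow : ∀ k c d, ForestModel T ⊨ belowSentence k c d ↔ Below k c d := by
    intro k c d
    simp only [belowSentence, Sentence.Realize, Formula.Realize, BoundedFormula.realize_rel₂, hterm]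
    exact Iff.rfl
  refine Theory.Model.union (Theory.Model.union (Theory.Model.union ?_ ?_) ?_) ?_
  · exact (LHom.onTheory_model _ _).2 (forestModel_isModel hT)
  · rw [model_distinctConstantsTheory]
    intro c _ d _ h
    exact Sum.inl_injective h
  · refine ⟨?_⟩
    rintro φ (⟨i, j, k, m, ⟨h, rfl⟩ | ⟨h, rfl⟩⟩ | ⟨i, j, k, m, m', ⟨h, rfl⟩ | ⟨h, rfl⟩⟩)
    · exact (hlevel _ _).2 h
    · exact (Sentence.realize_not _).2 fun h' => h ((hlevel _ _).1 h')
    · exact (hbelow _ _ _).2 (constForest_below.2 ⟨rfl, rfl, h⟩)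
    · refine (Sentence.realize_not _).2 fun h' => ?_
      obtain ⟨_, -, hb⟩ := constForest_below.1 ((hbelow _ _ _).1 h')
      exact h hb
  · refine ⟨?_⟩
    rintro φ ⟨i, j, k, rfl⟩
    simp only [closureAx, Sentence.Realize, Formula.Realize, BoundedFormula.realize_all,
      BoundedFormula.realize_imp, BoundedFormula.realize_inf, BoundedFormula.realize_sup,
      BoundedFormula.realize_iSup, BoundedFormula.realize_bdEqual, BoundedFormula.realize_rel₂,
      hterm]
    intro a b
    change ((∃ m : Rep i, a = const ⟨i, j, m⟩) ∧ (Below k a b ∨ Below k b a)) →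
      ∃ m : Rep i, b = const ⟨i, j, m⟩
    rintro ⟨⟨m, rfl⟩, h⟩
    induction b using ForestModel.cases with
    | h₂ s => exact (h.elim not_below_const_node not_below_node_const).elim
    | h₁ c =>
      obtain ⟨i', j', m'⟩ := c
      obtain h | h := h
      · obtain ⟨rfl, rfl, -⟩ := constForest_below.1 (below_const.1 h)
        exact ⟨m', rfl⟩
      · obtain ⟨rfl, rfl, -⟩ := constForest_below.1 (below_const.1 h)
        exact ⟨m', rfl⟩

/-! ### The type of the root -/

open ForestModel

theorem isKind_combined (j : ℕ) : ∃ b, IsKind b j (backForth j).1 :=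
  ⟨true, (isKind_backForth j).1⟩

theorem prefixClosed_combinedTree : PrefixClosed combinedTree := by
  rw [combinedTree_eq_graft]
  exact prefixClosed_graft fun j => (isKind_backForth j).1.prefixClosed

instance combined_isModel : ForestModel combinedTree ⊨ treeTheory :=
  forestModel_isModel_treeTheory prefixClosed_combinedTree

/-- The type of the root in the model `M`. -/
noncomputable def rootType : treeTheory.CompleteType (Fin 1) :=
  treeTheory.typeOf (M := ForestModel combinedTree) fun _ => root combinedTree

theorem mem_rootType {ψ : (treeLang[[Fin 1]]).Sentence} :
    ψ ∈ (rootType : (treeLang[[Fin 1]]).Theory) ↔ ForestModel combinedTree ⊨ ψ := Iff.rfl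

/-- With `T` a variable, the equation can be substituted in the types that depend on the tree. -/
theorem definable_nodeG {T : Set (List ℕ)} [IsRooted T] (hT : T = graft fun k => (backForth k).1)
    {k : ℕ} (hk : nodeG k ∈ T) :
    ({root T} : Set (ForestModel T)).Definable₁ forestLang {node ⟨nodeG k, hk⟩} := by
  subst hT
  refine Set.definable_iff_exists_formula_sum.2
    ⟨(forkNode k ⊓ tall k (2 * k + 2) 1).relabel fun i =>
      if i = 0 then Sum.inl ⟨_, rfl⟩ else Sum.inr 0, ?_⟩
  ext v
  have hK := (IsKind.tall_iff (isKind_backForth k).1).2 rfl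
  simp only [Set.mem_ofPred_eq, Formula.realize_relabel]
  rw [realize_forkNode_inf_tall isKind_combined (by simp)]
  simp [hK]

/-- The sentence saying that the tree above `G_{k+1}` is a copy of `E_{k+1}`. -/
noncomputable def tallSentence (k : ℕ) : (treeLang[[Fin 1]]).Sentence :=
  Formula.equivSentence ((forestLang.lhomWithConstants NewConst).onFormula
    ((exVar 1 (forkNode k ⊓ tall k (2 * k + 2) 1)).relabel fun _ => (0 : Fin 1)))

theorem realize_tallSentence {Q : ℕ → Set (List ℕ)} (hQ : ∀ j, ∃ b, IsKind b j (Q j)) (k : ℕ) :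
    ForestModel (graft Q) ⊨ tallSentence k ↔ IsKind true k (Q k) := by
  rw [tallSentence, Formula.realize_equivSentence, LHom.realize_onFormula,
    Formula.realize_relabel, realize_exVar_tall hQ]
  rfl

/-- One wrong graft violates its `tallSentence`; if all grafts are right, the structure is
isomorphic to `M` with the root named. -/
theorem model_rootType_iff {Q : ℕ → Set (List ℕ)} (hQ : ∀ j, ∃ b, IsKind b j (Q j)) :
    (∀ ψ ∈ (rootType : (treeLang[[Fin 1]]).Theory), ForestModel (graft Q) ⊨ ψ) ↔
      ∀ k, IsKind true k (Q k) := by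
  constructor
  · intro h k
    refine (realize_tallSentence hQ k).1 (h _ (mem_rootType.2 ?_))
    have : ∀ (T : Set (List ℕ)) [IsRooted T], T = graft (fun k => (backForth k).1) →
        ForestModel T ⊨ tallSentence k := by
      rintro T _ rfl
      exact (realize_tallSentence isKind_combined k).2 (isKind_backForth k).1
    exact this _ combinedTree_eq_graft
  · intro h ψ hψ
    have iso : TreeIso combinedTree (graft Q) := by
      rw [combinedTree_eq_graft]
      exact .graft_congr fun k => (isKind_backForth k).1.treeIso (h k)
    obtain ⟨g⟩ := exists_equiv_of_treeIso prefixClosed_combinedTree iso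
    exact (StrongHomClass.realize_sentence g ψ).1 (mem_rootType.1 hψ)

/-- Every `Π⁰_ω` set is reduced to the models of the type by a continuous family of structures. -/
theorem exists_structures {S : Set (ℕ → Bool)} (hS : S ∈ boldPiOmega) :
    ∃ R : (ℕ → Bool) → (treeLang[[Fin 1]]).Structure ℕ, ContinuousStructures R ∧
      ∀ x, x ∈ S ↔ ∀ ψ ∈ (rootType : (treeLang[[Fin 1]]).Theory), @Sentence.Realize _ ℕ (R x) ψ := by
  obtain ⟨t, ht, rfl⟩ := exists_iInter_boldSigma hS
  choose T hT hT₁ hT₂ using fun k => exists_family_isKind k (t k) (ht k)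
  refine ⟨fun x => natModel (graft fun k => T k x),
    continuousStructures_natModel (T := fun x => graft fun k => T k x) (.graft hT), fun x => ?_⟩
  have hQ : ∀ j, ∃ b, IsKind b j (T j x) := fun j => by
    by_cases hx : x ∈ t j
    exacts [⟨_, hT₁ j x hx⟩, ⟨_, hT₂ j x hx⟩]
  simp only [realize_natModel]
  rw [model_rootType_iff hQ, Set.mem_iInter]
  refine forall_congr' fun k => ⟨hT₁ k x, fun h => ?_⟩
  -- Outside `t k` the graft has kind `A`, and `Tall k` shows that the two kinds exclude each other.
  by_contra hx
  have h' := (hT₂ k x hx).tall_iff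
  rw [h.tall_iff] at h'
  simp at h'

theorem isPiOmegaHard_rootType {e : ℕ → AtomicSentence (treeLang[[Fin 1]])}
    (he : Function.Surjective e) :
    IsPiOmegaHard (modSet e (rootType : (treeLang[[Fin 1]]).Theory)) := by
  intro S hS
  obtain ⟨R, hR, hRS⟩ := exists_structures hS
  refine ⟨fun x => atomicDiagram e (R x), hR.continuous_atomicDiagram e, fun x => ?_⟩
  rw [hRS]
  constructor
  · exact fun h => ⟨R x, @Theory.Model.mk _ ℕ (R x) _ h, rfl⟩
  · rintro ⟨R', hR', h⟩
    -- Some model of the type has this diagram; by injectivity it is `R x` itself.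
    obtain rfl := atomicDiagram_injective he h
    exact hR'.realize_of_mem

theorem countable_sentences : Countable (treeLang[[Fin 1]]).Sentence :=
  inferInstanceAs (Countable ((treeLang[[Fin 1]]).Formula Empty))

/-- Reduce to the models of the type a `Σ⁰_{n+1}` set `U` whose complement is not `Σ⁰_{n+1}`. By the
axioms, `Uᶜ` would be the countable union, over `φ ∈ Γ`, of the `Σ⁰_{n+1}` sets where `φ` fails. -/
theorem not_isForallAxiomatizable_rootType (n : ℕ) :
    ¬ IsForallAxiomatizable n (rootType : (treeLang[[Fin 1]]).Theory) := by
  rintro ⟨Γ, hΓ, hΓ'⟩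
  obtain ⟨U, hU, hU'⟩ := exists_boldSigma_compl_notMem n
  obtain ⟨R, hR, hRU⟩ := exists_structures (boldPiOmega_of_boldSigma hU)
  have key : Uᶜ = ⋃ φ : Γ, {x | @Sentence.Realize _ ℕ (R x) φ.1}ᶜ := by
    ext x
    simp only [Set.mem_compl_iff, Set.mem_iUnion, Set.mem_ofPred_eq, ← not_forall, hRU,
      Subtype.forall]
    refine not_congr ⟨fun h φ hφ => ?_, fun h ψ hψ => ?_⟩
    · have hm := (hΓ' φ).1 (Theory.models_sentence_of_mem hφ)
      let := R x
      have : ℕ ⊨ (rootType : (treeLang[[Fin 1]]).Theory) := ⟨h⟩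
      exact hm.realize_sentence ℕ
    · have hm := (hΓ' ψ).2 (Theory.models_sentence_of_mem hψ)
      let := R x
      have : ℕ ⊨ Γ := ⟨h⟩
      exact hm.realize_sentence ℕ
  have := countable_sentences
  refine hU' ?_
  rw [key]
  exact boldSigma_iUnion fun φ => (hR.boldSigma_of_prenexClass _ n).2 _ _ _ (hΓ φ.1 φ.2)

end UnboundedType

theorem mainTheorem3 :
    ∃ p : treeTheory.CompleteType (Fin 1),
      -- `p` is the type of the root in the model, and each `G_{k+1}` is definable from the root
      (∀ φ : treeLang.Formula (Fin 1),
        Formula.equivSentence φ ∈ p ↔ φ.Realize (fun _ => rootM)) ∧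
      (∀ k : ℕ, ({rootM} : Set BigModel).Definable₁ forestLang {nodeGM k}) ∧
      -- the set of models of `p` is `Π⁰_ω`-hard
      (∀ e : ℕ → AtomicSentence (treeLang[[Fin 1]]), Function.Surjective e →
        IsPiOmegaHard (modSet e (p : (treeLang[[Fin 1]]).Theory))) ∧
      -- `p` is not `∀ₙ`-axiomatizable
      ∀ n : ℕ, ¬ IsForallAxiomatizable n (p : (treeLang[[Fin 1]]).Theory) := by
  refine ⟨rootType, fun φ => ?_, fun k => ?_, fun e he => isPiOmegaHard_rootType he,
    not_isForallAxiomatizable_rootType⟩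
  -- `ForestModel combinedTree` and `BigModel` agree by unfolding, including the interpretation of
  -- the symbols.
  · exact Theory.CompleteType.formula_mem_typeOf (M := ForestModel combinedTree)
  · exact definable_nodeG combinedTree_eq_graft (nodeG_mem k)
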